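/- Fix predicate symbols with positive arities, an infinite set of constants, and two disjoint countably infinite sorts of variables: regular variables and copy variables. A \emph{term} is a regular variable or a constant. A \emph{relational atom} is $p(\bar S)$ with $\bar S$ a tuple of terms of the length given by the arity of $p$; a \emph{copy-sensitive atom} is $p(\bar S;i)$ with $i$ a copy variable; in both cases $p(\bar S)$ is its \emph{relational template}. A \emph{CCQ query} is an expression $Q(\bar X)\leftarrow L,M$, where $\bar X$ is a possibly empty vector of terms, $L$ is a nonempty finite conjunction of relational and copy-sensitive atoms (its \emph{subgoals}; duplicates allowed) in which every copy variable occurs at most once and in which all variables of $\bar X$ occur, and $M$ is a set of variables of $L$ not occurring in $\bar X$ that contains the set $M_{copy}$ of all copy variables of $L$. Put $M_{noncopy}=M\setminus M_{copy}$. A \emph{database} $D$ is a finite set of ground atoms $p(\bar c)$, each with a copy number $N\ge 1$. A \emph{satisfying assignment} of $Q$ in $D$ maps the regular variables of $L$ to constants (and constants to themselves) and the copy variables of $L$ to positive integers, so that for each relational $p(\bar S)\in L$ the image of $p(\bar S)$ is in $D$, and for each $p(\bar S;i)\in L$ the image of $p(\bar S)$ is in $D$ with copy number at least the value of $i$. The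 bag $\mathrm{Res}_C(Q,D)$ contains one copy of $\gamma(\bar X)$ for each distinct restriction $\gamma$ of a satisfying assignment to the variables in $\bar X$ and $M$. We write $Q\equiv_C Q'$ if $\mathrm{Res}_C(Q,D)=\mathrm{Res}_C(Q',D)$ as bags for every database $D$. Let $Q'(\bar X')\leftarrow L',M'$ and $Q(\bar X)\leftarrow L,M$ be CCQ queries. Below, $\mu$ maps the terms of $Q'$ to terms of $Q$ and the copy variables of $Q'$ to copy variables of $Q$, is the identity on constants, and satisfies $\mu(\bar X')=\bar X$. - $\mu$ is a \emph{generalized containment mapping} (GCM) from $Q'$ to $Q$ if the image of every subgoal of $Q'$ is a subgoal of $Q$. - $\mu$ is a \emph{covering mapping} (CVM) from $Q'$ to $Q$ if $\mu(M'_{copy})=M_{copy}$; $\mu(M'_{noncopy})\supseteq M_{noncopy}$; for each relational subgoal $s(\bar Y)$ of $Q'$, some subgoal of $Q$ (relational or copy-sensitive) has relational template $s(\mu(\bar Y))$; and for each copy-sensitive subgoal $s(\bar Y;i)$ of $Q'$, the atom $s(\mu(\bar Y);\mu(i))$ is a subgoal of $Q$. Let $Q_{ce}$ be obtained from $Q$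 by adding a distinct fresh copy variable to each relational subgoal. The query $Q$ is \emph{explicit-wave} if (1) it has at most one copy-sensitive subgoal, or (2) whenever $\mu_1,\mu_2$ are GCMs from $Q_{ce}$ to itself that restrict to the same bijection of $M_{noncopy}$ onto itself, then for each copy-sensitive subgoal $s$ of $Q$ the atoms $\mu_1(s)$ and $\mu_2(s)$ have the same relational template. **Theorem.** Let $Q_1,Q_2$ be explicit-wave CCQ queries. Then $Q_1\equiv_C Q_2$ if and only if there exist a CVM from $Q_1$ to $Q_2$ and a CVM from $Q_2$ to $Q_1$. Consequently, if predicate symbols and constants are effectively encoded (so that queries are finite strings), then combined-semantics equivalence is decidable for explicit-wave queries: there is an algorithm which, given any two explicit-wave CCQ queries $Q_1,Q_2$, determines whether $Q_1\equiv_C Q_2$. -/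

import Mathlib

/-- A term: a (regular) variable, named by a natural number, or a constant.
Copy variables form a separate sort, also named by natural numbers, and never occur as terms. -/
inductive Term (C : Type*) where
  | var (x : ℕ)
  | const (c : C)

/-- A subgoal: the relational atom `p(S₁, …, Sₙ)` if `copy = none`, and the copy-sensitive atom
`p(S₁, …, Sₙ; i)` if `copy = some i`. -/
structure Subgoal (P C : Type*) where
  pred : P
  args : List (Term C)
  copy : Option ℕ

/-- The data of an expression `Q(X̄) ← L, M`. The list `body` is the condition `L` (duplicates are
allowed). Since `M` has to contain all copy variables of `L`, it is given by its remaining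
elements, the multiset noncopy variables `noncopy` (a list read as a set). -/
structure Query (P C : Type*) where
  head : List (Term C)
  body : List (Subgoal P C)
  noncopy : List ℕ

namespace Query

variable {P C : Type*}

/-- The copy variables of the condition, one for each copy-sensitive subgoal;
as a set this is `M_copy`. -/
def copyVars (Q : Query P C) : List ℕ := Q.body.filterMap Subgoal.copy

/-- The terms (variables and constants) of the query. -/
def terms (Q : Query P C) : Set (Term C) :=
  {t | t ∈ Q.head ∨ ∃ g ∈ Q.body, t ∈ g.args}

/-- The set `M_noncopy`, as a set of terms. -/
def noncopyTerms (Q : Query P C) : Set (Term C) := {t | ∃ x ∈ Q.noncopy, t = Term.var x}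

/-- `Q` is a CCQ query over the predicate symbols `P` with the given arities. -/
structure IsCCQ (arity : P → ℕ+) (Q : Query P C) : Prop where
  body_ne_nil : Q.body ≠ []
  args_length : ∀ g ∈ Q.body, g.args.length = arity g.pred
  copyVars_nodup : Q.copyVars.Nodup
  safe : ∀ x, Term.var x ∈ Q.head → ∃ g ∈ Q.body, Term.var x ∈ g.args
  noncopy_nondistinguished : ∀ x ∈ Q.noncopy, Term.var x ∉ Q.head
  noncopy_in_body : ∀ x ∈ Q.noncopy, ∃ g ∈ Q.body, Term.var x ∈ g.args

end Query

/-- A finite database: `copies (p, c̄)` is the number of copies of the ground atom `p(c̄)`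
in the database (`0` if the atom is absent). -/
structure Database {P : Type*} (arity : P → ℕ+) (C : Type*) where
  copies : P × List C →₀ ℕ
  args_length : ∀ a, copies a ≠ 0 → a.2.length = arity a.1

/-- An assignment of constants to the regular variables and of natural numbers to the
copy variables. -/
structure Assignment (C : Type*) where
  onVar : ℕ → C
  onCopy : ℕ → ℕ

namespace Assignment

variable {P C : Type*}

/-- The value of a term; the identity on constants. -/
def eval (γ : Assignment C) : Term C → C
  | Term.var x => γ.onVar x
  | Term.const c => c

/-- The subgoal `g` is satisfied in `D` under `γ`. -/
def Satisfies {arity : P → ℕ+} (γ : Assignment C) (D : Database arity C) (g : Subgoal P C) :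
    Prop :=
  match g.copy with
  | none => 1 ≤ D.copies (g.pred, g.args.map γ.eval)
  | some i => 1 ≤ γ.onCopy i ∧ γ.onCopy i ≤ D.copies (g.pred, g.args.map γ.eval)

end Assignment

namespace Query

variable {P C : Type*}

/-- The regular nonset variables: the distinguished and the multiset noncopy variables. -/
def nonsetVars (Q : Query P C) : Set ℕ := {x | Term.var x ∈ Q.head ∨ x ∈ Q.noncopy}

/-- The satisfying assignments `Γ(Q, D)`; the values on names that do not occur in the query
are arbitrary. -/
def satAssignments (Q : Query P C) {arity : P → ℕ+} (D : Database arity C) :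
    Set (Assignment C) :=
  {γ | ∀ g ∈ Q.body, γ.Satisfies D g}

/-- Restriction of an assignment to the nonset variables of `Q` (distinguished variables,
multiset noncopy variables and copy variables). -/
def restrict (Q : Query P C) (γ : Assignment C) :
    ({x // x ∈ Q.nonsetVars} → C) × ({i // i ∈ Q.copyVars} → ℕ) :=
  (fun x => γ.onVar x.1, fun i => γ.onCopy i.1)

/-- The multiplicity of the tuple `t` in the bag `Res_C(Q, D)`: the number of satisfiably
extendible assignments of the nonset variables that map the head vector to `t` (the head
involves nonset variables only, so it may be evaluated on any extension). -/
noncomputable def resMultiplicity (Q : Query P C) {arity : P → ℕ+} (D : Database arity C)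
    (t : List C) : ℕ∞ :=
  (Q.restrict '' {γ | γ ∈ Q.satAssignments D ∧ Q.head.map γ.eval = t}).encard

/-- Combined-semantics containment: on every database, `Res_C(Q, D)` is a subbag
of `Res_C(Q', D)`. -/
def ContainedC (arity : P → ℕ+) (Q Q' : Query P C) : Prop :=
  ∀ (D : Database arity C) (t : List C), Q.resMultiplicity D t ≤ Q'.resMultiplicity D t

/-- Combined-semantics equivalence. -/
def EquivC (arity : P → ℕ+) (Q Q' : Query P C) : Prop :=
  ContainedC arity Q Q' ∧ ContainedC arity Q' Q

end Query

/-- A mapping between the terms and between the copy variables of two queries. -/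
structure Mapping (C : Type*) where
  onTerm : Term C → Term C
  onCopy : ℕ → ℕ

namespace Mapping

variable {P C : Type*}

/-- The image of a subgoal under a mapping. -/
def applySubgoal (μ : Mapping C) (g : Subgoal P C) : Subgoal P C where
  pred := g.pred
  args := g.args.map μ.onTerm
  copy := g.copy.map μ.onCopy

/-- `μ` is a generalized containment mapping (GCM) from `Q'` to `Q`. -/
structure IsGCM (μ : Mapping C) (Q' Q : Query P C) : Prop where
  mapsTo_terms : ∀ t ∈ Q'.terms, μ.onTerm t ∈ Q.terms
  mapsTo_copyVars : ∀ i ∈ Q'.copyVars, μ.onCopy i ∈ Q.copyVars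
  head : Q'.head.map μ.onTerm = Q.head
  const : ∀ c, Term.const c ∈ Q'.terms → μ.onTerm (Term.const c) = Term.const c
  body : ∀ g ∈ Q'.body, μ.applySubgoal g ∈ Q.body

/-- `μ` is a covering mapping (CVM) from `Q'` to `Q`. -/
structure IsCVM (μ : Mapping C) (Q' Q : Query P C) : Prop where
  mapsTo_terms : ∀ t ∈ Q'.terms, μ.onTerm t ∈ Q.terms
  mapsTo_copyVars : ∀ i ∈ Q'.copyVars, μ.onCopy i ∈ Q.copyVars
  const : ∀ c, Term.const c ∈ Q'.terms → μ.onTerm (Term.const c) = Term.const c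
  head : Q'.head.map μ.onTerm = Q.head
  copy_image : μ.onCopy '' {i | i ∈ Q'.copyVars} = {i | i ∈ Q.copyVars}
  noncopy_image : Q.noncopyTerms ⊆ μ.onTerm '' Q'.noncopyTerms
  relational : ∀ g ∈ Q'.body, g.copy = none →
    ∃ h ∈ Q.body, h.pred = g.pred ∧ h.args = g.args.map μ.onTerm
  copySensitive : ∀ g ∈ Q'.body, ∀ i, g.copy = some i →
    ∃ h ∈ Q.body, h.pred = g.pred ∧ h.args = g.args.map μ.onTerm ∧ h.copy = some (μ.onCopy i)

/-- `μ` is a noncopy-permuting GCM from `Q` to itself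
(every GCM from `Q` to itself is one if `M_noncopy = ∅`). -/
def IsNoncopyPermuting (μ : Mapping C) (Q : Query P C) : Prop :=
  μ.IsGCM Q Q ∧ Set.BijOn μ.onTerm Q.noncopyTerms Q.noncopyTerms

end Mapping

namespace Query

variable {P C : Type*}

/-- A strict upper bound for the names of the copy variables of `Q`. -/
def freshCopy (Q : Query P C) : ℕ := Q.copyVars.foldr max 0 + 1

/-- The copy-enhanced version of `Q`, unique up to the names of the new copy variables: the `k`-th
subgoal, if relational, receives the fresh copy variable `freshCopy Q + k`. -/
def copyEnhanced (Q : Query P C) : Query P C where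
  head := Q.head
  body := Q.body.mapIdx fun k g => { g with copy := some (g.copy.getD (Q.freshCopy + k)) }
  noncopy := Q.noncopy

/-- Explicit-wave queries. Condition (2) ranges over the copy-sensitive subgoals `s` of `Q`
itself; the relational templates of `μ₁(s)` and `μ₂(s)` have the same predicate. -/
def ExplicitWave (Q : Query P C) : Prop :=
  Q.copyVars.length ≤ 1 ∨
  ∀ μ₁ μ₂ : Mapping C,
    μ₁.IsNoncopyPermuting Q.copyEnhanced → μ₂.IsNoncopyPermuting Q.copyEnhanced →
    Set.EqOn μ₁.onTerm μ₂.onTerm Q.noncopyTerms →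
    ∀ s ∈ Q.body, s.copy.isSome →
      (μ₁.applySubgoal s).args = (μ₂.applySubgoal s).args

end Query

/-! Encodings of queries as finite objects, for stating decidability. -/

/-- Terms as a sum type. -/
def Term.equivSum (C : Type*) : Term C ≃ ℕ ⊕ C where
  toFun
    | Term.var x => Sum.inl x
    | Term.const c => Sum.inr c
  invFun
    | Sum.inl x => Term.var x
    | Sum.inr c => Term.const c
  left_inv t := by cases t <;> rfl
  right_inv s := by cases s <;> rfl

/-- Subgoals as triples. -/
def Subgoal.equivProd (P C : Type*) : Subgoal P C ≃ P × List (Term C) × Option ℕ where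
  toFun g := (g.pred, g.args, g.copy)
  invFun a := ⟨a.1, a.2.1, a.2.2⟩
  left_inv _ := rfl
  right_inv _ := rfl

/-- Queries as triples. -/
def Query.equivProd (P C : Type*) :
    Query P C ≃ List (Term C) × List (Subgoal P C) × List ℕ where
  toFun Q := (Q.head, Q.body, Q.noncopy)
  invFun a := ⟨a.1, a.2.1, a.2.2⟩
  left_inv _ := rfl
  right_inv _ := rfl

instance Term.instPrimcodable (C : Type*) [Primcodable C] : Primcodable (Term C) :=
  Primcodable.ofEquiv _ (Term.equivSum C)

instance Subgoal.instPrimcodable (P C : Type*) [Primcodable P] [Primcodable C] :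
    Primcodable (Subgoal P C) :=
  Primcodable.ofEquiv _ (Subgoal.equivProd P C)

instance Query.instPrimcodable (P C : Type*) [Primcodable P] [Primcodable C] :
    Primcodable (Query P C) :=
  Primcodable.ofEquiv _ (Query.equivProd P C)

/-! ### Finite counting -/

section Counting

variable {α β ι T : Type*}

/-! Sufficiency: composing with a CVM from `Q'` to `Q` sends results of `Q` injectively to results
of `Q'`, so CVMs both ways give equal bags (`containedC_of_isCVM`).

Necessity: test databases are blown up from `Q`. Every variable is represented by two constants, and
every template `τ` is present in all its representations with `n τ` copies, except that second
constants are admitted only for a set `S` of multiset noncopy variables. Comparing all `S` isolates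
the results that use every second constant (`coveringCount_eq`). Such results come from template
homomorphisms into `Q` that cover its multiset noncopy variables; each such homomorphism yields at
least the product of `n` over the images of the copy-sensitive subgoals, and the number of shapes of
results is bounded independently of `n`. Taking `n = N ^ w` with `N` large shows that, for every
weight `w`, a covering homomorphism from one query is matched by one from the other of at least the
same total weight (`exists_hom_weight_le`).

Let `a` be the vector of multiplicities of the templates of copy-sensitive subgoals of `Q`. The
weight `a` and the identity give `f` from `Q'` to `Q`, with vector `b` of images, such that `|a|² ≤
⟨a, b⟩`. The weight `b` and `f` give `g` from `Q` to itself, with vector `a_g`, such that `|b|² ≤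
⟨b, a_g⟩`, hence `|b| ≤ |a_g|`. For an explicit-wave query `g` cannot merge different templates of
copy-sensitive subgoals (`copyImage_id_eq`), so `|a_g| ≤ |a|`. Therefore `|a - b|² ≤ 0`, so `a = b`,
and a bijection of copy variables extends `f` to a CVM.

Decidability: only the finite graph of a CVM on the terms and copy variables of the query matters,
and these graphs can be searched. -/

theorem Finset.card_filter_subset_eq_add_sum [DecidableEq ι] (A : Finset α) (f : α → Finset ι)
    (S : Finset ι) :
    (A.filter fun a => f a ⊆ S).card =
      (A.filter fun a => f a = S).card +
        ∑ R ∈ S.ssubsets, (A.filter fun a => f a = R).card := by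
  rw [Finset.card_eq_sum_card_fiberwise (f := f) (t := S.powerset)
    (fun a ha => by simpa using (Finset.mem_filter.1 ha).2)]
  have : S.powerset = insert S S.ssubsets := by
    ext R
    simp only [Finset.mem_powerset, Finset.mem_insert, Finset.mem_ssubsets]
    exact le_iff_eq_or_lt
  rw [this, Finset.sum_insert (by simp [Finset.mem_ssubsets])]
  have aux : ∀ R ⊆ S, ((A.filter fun a => f a ⊆ S).filter fun a => f a = R)
      = A.filter fun a => f a = R := by
    intro R hR
    ext a
    simp only [Finset.mem_filter]
    constructor
    · rintro ⟨⟨h1, -⟩, h2⟩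
      exact ⟨h1, h2⟩
    · rintro ⟨h1, h2⟩
      exact ⟨⟨h1, h2 ▸ hR⟩, h2⟩
  rw [aux S subset_rfl]
  congr 1
  exact Finset.sum_congr rfl fun R hR => by rw [aux R (Finset.mem_ssubsets.1 hR).1]

/-- Finite sets with the same number of labels below every set have the same number of labels
equal to any set. -/
theorem Finset.card_filter_eq_of_card_filter_subset [DecidableEq ι] (A : Finset α) (B : Finset β)
    (f : α → Finset ι) (g : β → Finset ι) (U : Finset ι)
    (H : ∀ S ⊆ U, (A.filter fun a => f a ⊆ S).card = (B.filter fun b => g b ⊆ S).card) :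
    ∀ S ⊆ U, (A.filter fun a => f a = S).card = (B.filter fun b => g b = S).card := by
  intro S
  -- Inversion over the subset lattice: the labels properly inside `S` are equally frequent by
  -- induction, and they cancel from the cumulative counts.
  induction S using Finset.strongInduction with
  | H S ih =>
    intro hS
    have h := H S hS
    rw [card_filter_subset_eq_add_sum A f S, card_filter_subset_eq_add_sum B g S,
      Finset.sum_congr rfl fun R hR =>
      ih R (Finset.mem_ssubsets.1 hR) ((Finset.mem_ssubsets.1 hR).1.trans hS)] at h
    exact Nat.add_right_cancel h

variable [Fintype α] [Fintype β] [DecidableEq T]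

/-- The number of indices at which a family takes the value `τ`. -/
def fiberCard (a : α → T) (τ : T) : ℕ := (Finset.univ.filter fun i => a i = τ).card

theorem sum_comp_eq_sum_fiberCard (a : α → T) (w : T → ℕ) (U : Finset T) (hU : ∀ i, a i ∈ U) :
    ∑ i, w (a i) = ∑ τ ∈ U, fiberCard a τ * w τ := by
  rw [← Finset.sum_fiberwise_of_maps_to (s := Finset.univ) (t := U) (g := a) (fun i _ => hU i)]
  refine Finset.sum_congr rfl fun τ _ => ?_
  rw [Finset.sum_congr rfl (g := fun _ => w τ) (fun i hi => by rw [(Finset.mem_filter.1 hi).2])]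
  simp [fiberCard]

/-- Both sides are the inner product of the two multiplicity vectors. -/
theorem sum_fiberCard_comm (a : α → T) (b : β → T) :
    ∑ i, fiberCard b (a i) = ∑ j, fiberCard a (b j) := by
  classical
  rw [sum_comp_eq_sum_fiberCard a (fiberCard b) (Finset.univ.image a ∪ Finset.univ.image b)
      (by simp),
    sum_comp_eq_sum_fiberCard b (fiberCard a) (Finset.univ.image a ∪ Finset.univ.image b)
      (by simp)]
  exact Finset.sum_congr rfl fun τ _ => mul_comm _ _

/-- Expansion of the squared distance of the multiplicity vectors of two families. -/
theorem sum_sq_fiberCard_sub (a : α → T) (b : β → T) (U : Finset T) (ha : ∀ i, a i ∈ U)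
    (hb : ∀ j, b j ∈ U) :
    ∑ τ ∈ U, ((fiberCard a τ : ℤ) - fiberCard b τ) ^ 2 =
      (∑ i, fiberCard a (a i) : ℕ) - 2 * (∑ i, fiberCard b (a i) : ℕ)
        + (∑ j, fiberCard b (b j) : ℕ) := by
  rw [sum_comp_eq_sum_fiberCard a (fiberCard a) U ha,
    sum_comp_eq_sum_fiberCard a (fiberCard b) U ha,
    sum_comp_eq_sum_fiberCard b (fiberCard b) U hb]
  push_cast
  rw [Finset.mul_sum, ← Finset.sum_sub_distrib, ← Finset.sum_add_distrib]
  exact Finset.sum_congr rfl fun τ _ => by ring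

theorem two_mul_sum_fiberCard_le (a : α → T) (b : β → T) :
    2 * ∑ i, fiberCard b (a i) ≤ ∑ i, fiberCard a (a i) + ∑ j, fiberCard b (b j) := by
  classical
  have h := sum_sq_fiberCard_sub a b (Finset.univ.image a ∪ Finset.univ.image b)
    (by simp) (by simp)
  have h' : 0 ≤ ∑ τ ∈ Finset.univ.image a ∪ Finset.univ.image b,
      ((fiberCard a τ : ℤ) - fiberCard b τ) ^ 2 := Finset.sum_nonneg fun _ _ => sq_nonneg _
  omega

/-- From `|a|² ≤ ⟨a, b⟩` and `|b|² ≤ |a|²` follows `|a - b|² ≤ 0`. -/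
theorem fiberCard_eq_of_le (a : α → T) (b : β → T)
    (h₁ : ∑ i, fiberCard a (a i) ≤ ∑ i, fiberCard b (a i))
    (h₂ : ∑ j, fiberCard b (b j) ≤ ∑ i, fiberCard a (a i)) (τ : T) :
    fiberCard a τ = fiberCard b τ := by
  classical
  -- Including `τ` makes it a summand even if neither family takes this value.
  set U := insert τ (Finset.univ.image a ∪ Finset.univ.image b)
  have h := sum_sq_fiberCard_sub a b U (by simp [U]) (by simp [U])
  have h' : ((fiberCard a τ : ℤ) - fiberCard b τ) ^ 2 ≤ _ :=
    Finset.single_le_sum (f := fun τ => ((fiberCard a τ : ℤ) - fiberCard b τ) ^ 2)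
      (fun _ _ => sq_nonneg _) (Finset.mem_insert_self τ _ : τ ∈ U)
  have h0 : ((fiberCard a τ : ℤ) - fiberCard b τ) ^ 2 ≤ 0 :=
    (h'.trans_eq h).trans (by omega)
  have := pow_eq_zero_iff (two_ne_zero) |>.1 (le_antisymm h0 (sq_nonneg _))
  omega

theorem exists_equiv_of_fiberCard_eq (a : α → T) (b : β → T)
    (h : ∀ τ, fiberCard a τ = fiberCard b τ) : ∃ σ : α ≃ β, ∀ i, b (σ i) = a i := by
  have : ∀ τ, Nonempty ({i // a i = τ} ≃ {j // b j = τ}) := fun τ =>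
    Fintype.card_eq.1 (by simpa [fiberCard, Fintype.card_subtype] using h τ)
  exact ⟨Equiv.ofFiberEquiv fun τ => (this τ).some, Equiv.ofFiberEquiv_map _⟩

end Counting

namespace Query

variable {P C : Type*}

/-! ### Containment from a covering mapping -/

theorem mem_terms_of_mem_nonsetVars {arity : P → ℕ+} {Q : Query P C} (hQ : Q.IsCCQ arity) {x : ℕ}
    (hx : x ∈ Q.nonsetVars) : ∃ g ∈ Q.body, Term.var x ∈ g.args :=
  hx.elim (hQ.safe x) (hQ.noncopy_in_body x)

theorem mem_copyVars {Q : Query P C} {i : ℕ} :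
    i ∈ Q.copyVars ↔ ∃ g ∈ Q.body, g.copy = some i := by
  simp [copyVars, List.mem_filterMap]

theorem eval_comp_onTerm {Q' Q : Query P C} {μ : Mapping C} (hμ : μ.IsCVM Q' Q)
    (γ : Assignment C) {t : Term C} (ht : t ∈ Q'.terms) :
    (Assignment.mk (fun x => γ.eval (μ.onTerm (.var x))) (fun i => γ.onCopy (μ.onCopy i))).eval t =
      γ.eval (μ.onTerm t) := by
  cases t with
  | var x => rfl
  | const c => rw [hμ.const c ht]; rfl

/-- Assignments are pulled back along `μ`. The pullback determines the result: head variables are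
fixed by the output tuple, and the remaining nonset variables are values of `μ` at nonset variables
of `Q'`. -/
theorem containedC_of_isCVM {arity : P → ℕ+} {Q' Q : Query P C} {μ : Mapping C}
    (hμ : μ.IsCVM Q' Q) : ContainedC arity Q Q' := by
  intro D t
  let pull : Assignment C → Assignment C := fun γ =>
    ⟨fun x => γ.eval (μ.onTerm (.var x)), fun i => γ.onCopy (μ.onCopy i)⟩
  have hargs : ∀ γ, ∀ g ∈ Q'.body,
      g.args.map (pull γ).eval = (g.args.map μ.onTerm).map γ.eval := by
    intro γ g hg
    rw [List.map_map]
    exact List.map_congr_left fun s hs => eval_comp_onTerm hμ γ (Or.inr ⟨g, hg, hs⟩)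
  have hhead : ∀ γ, Q'.head.map (pull γ).eval = Q.head.map γ.eval := by
    intro γ
    rw [← hμ.head, List.map_map]
    exact List.map_congr_left fun s hs => eval_comp_onTerm hμ γ (Or.inl hs)
  -- A copy-sensitive subgoal also guarantees one copy of its atom, so a relational subgoal may be
  -- mapped onto its template.
  have hpos : ∀ (γ : Assignment C), γ ∈ Q.satAssignments D → ∀ h ∈ Q.body,
      1 ≤ D.copies (h.pred, h.args.map γ.eval) := by
    intro γ hγ h hh
    have := hγ h hh
    unfold Assignment.Satisfies at this
    split at this
    · exact this
    · exact this.1.trans this.2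
  have hsat : ∀ γ ∈ Q.satAssignments D, pull γ ∈ Q'.satAssignments D := by
    intro γ hγ g hg
    unfold Assignment.Satisfies
    rw [hargs γ g hg]
    split
    · next hc =>
      obtain ⟨h, hh, hp, ha⟩ := hμ.relational g hg hc
      rw [← hp, ← ha]
      exact hpos γ hγ h hh
    · next i hc =>
      obtain ⟨h, hh, hp, ha, hc'⟩ := hμ.copySensitive g hg i hc
      have := hγ h hh
      unfold Assignment.Satisfies at this
      rw [hc'] at this
      rw [← hp, ← ha]
      exact this
  rcases isEmpty_or_nonempty (Assignment C) with hE | hE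
  · simp [resMultiplicity, Set.eq_empty_of_isEmpty]
  -- A result fixes only the nonset variables, whereas pulling back needs values everywhere; one
  -- satisfying extension is chosen for each result.
  have hsec : ∀ ρ, ∃ γ, ρ ∈ Q.restrict '' {γ | γ ∈ Q.satAssignments D ∧ Q.head.map γ.eval = t} →
      (γ ∈ Q.satAssignments D ∧ Q.head.map γ.eval = t) ∧ Q.restrict γ = ρ := by
    intro ρ
    by_cases h : ρ ∈ Q.restrict '' {γ | γ ∈ Q.satAssignments D ∧ Q.head.map γ.eval = t}
    · exact h.imp fun γ hγ _ => hγ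
    · exact ⟨hE.some, fun h' => absurd h' h⟩
  choose sec hsec using hsec
  refine (Set.InjOn.encard_image (f := fun ρ => Q'.restrict (pull (sec ρ))) ?_).symm.trans_le
    (Set.encard_le_encard ?_)
  · rintro ρ₁ h₁ ρ₂ h₂ he
    obtain ⟨⟨-, d₁⟩, r₁⟩ := hsec ρ₁ h₁
    obtain ⟨⟨-, d₂⟩, r₂⟩ := hsec ρ₂ h₂
    rw [← r₁, ← r₂]
    simp only [restrict, Prod.mk.injEq, funext_iff, Subtype.forall] at he ⊢
    refine ⟨fun x hx => ?_, fun i hi => ?_⟩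
    · rcases hx with hx | hx
      · exact List.map_inj_left.1 (d₁.trans d₂.symm) _ hx
      · obtain ⟨_, ⟨y, hy, rfl⟩, e⟩ := hμ.noncopy_image ⟨x, hx, rfl⟩
        have := he.1 y (Or.inr hy)
        simp only [pull, e] at this
        exact this
    · obtain ⟨j, hj, rfl⟩ := hμ.copy_image.symm.subset hi
      exact he.2 j hj
  · rintro _ ⟨ρ, h, rfl⟩
    obtain ⟨⟨s, d⟩, -⟩ := hsec ρ h
    exact ⟨_, ⟨hsat _ s, (hhead _).trans d⟩, rfl⟩

end Query

/-! ### Homomorphisms of relational templates -/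

namespace Query

variable {P C : Type*}

/-- A homomorphism of relational templates, preserving the head vector. -/
structure IsTemplateHom (h : Term C → Term C) (Q' Q : Query P C) : Prop where
  head : Q'.head.map h = Q.head
  const : ∀ c, Term.const c ∈ Q'.terms → h (Term.const c) = Term.const c
  body : ∀ g ∈ Q'.body, ∃ k ∈ Q.body, k.pred = g.pred ∧ k.args = g.args.map h

open Classical in
/-- The relational templates of the subgoals. -/
noncomputable def templates (Q : Query P C) : Finset (P × List (Term C)) :=
  (Q.body.map fun g => (g.pred, g.args)).toFinset

theorem mem_templates {Q : Query P C} {τ : P × List (Term C)} :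
    τ ∈ Q.templates ↔ ∃ g ∈ Q.body, g.pred = τ.1 ∧ g.args = τ.2 := by
  simp [templates, Prod.ext_iff]

/-- The copy-sensitive subgoal with a given copy variable. -/
noncomputable def subgoalOf (Q : Query P C) (i : {i // i ∈ Q.copyVars}) : Subgoal P C :=
  (mem_copyVars.1 i.2).choose

theorem subgoalOf_mem (Q : Query P C) (i : {i // i ∈ Q.copyVars}) : Q.subgoalOf i ∈ Q.body :=
  (mem_copyVars.1 i.2).choose_spec.1

theorem subgoalOf_copy (Q : Query P C) (i : {i // i ∈ Q.copyVars}) :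
    (Q.subgoalOf i).copy = some i.1 :=
  (mem_copyVars.1 i.2).choose_spec.2

theorem eq_of_copy_eq {Q : Query P C} (hQ : Q.copyVars.Nodup) {g g' : Subgoal P C}
    (hg : g ∈ Q.body) (hg' : g' ∈ Q.body) {i : ℕ} (h : g.copy = some i) (h' : g'.copy = some i) :
    g = g' := by
  have : ∀ l : List (Subgoal P C), (l.filterMap Subgoal.copy).Nodup → g ∈ l → g' ∈ l → g = g' := by
    intro l
    induction l with
    | nil => simp
    | cons k l ih =>
      intro hn hg hg'
      have hn' : (l.filterMap Subgoal.copy).Nodup := by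
        rw [List.filterMap_cons] at hn
        split at hn
        · exact hn
        · exact hn.of_cons
      rcases List.mem_cons.1 hg with rfl | hl <;> rcases List.mem_cons.1 hg' with rfl | hl'
      · rfl
      · rw [List.filterMap_cons_some h] at hn
        exact absurd (List.mem_filterMap.2 ⟨g', hl', h'⟩) (List.nodup_cons.1 hn).1
      · rw [List.filterMap_cons_some h'] at hn
        exact absurd (List.mem_filterMap.2 ⟨g, hl, h⟩) (List.nodup_cons.1 hn).1
      · exact ih hn' hl hl'
  exact this _ hQ hg hg'

theorem subgoalOf_eq {Q : Query P C} (hQ : Q.copyVars.Nodup) {g : Subgoal P C} (hg : g ∈ Q.body)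
    {i : ℕ} (h : g.copy = some i) (hi : i ∈ Q.copyVars) : Q.subgoalOf ⟨i, hi⟩ = g :=
  eq_of_copy_eq hQ (subgoalOf_mem _ _) hg (subgoalOf_copy _ _) h

/-- The image of the relational template of a copy-sensitive subgoal. -/
noncomputable def copyImage (Q : Query P C) (h : Term C → Term C) (i : {i // i ∈ Q.copyVars}) :
    P × List (Term C) :=
  ((Q.subgoalOf i).pred, (Q.subgoalOf i).args.map h)

/-- The multiset noncopy variables of `Q'` cover those of `Q`. -/
def CoversNoncopy (h : Term C → Term C) (Q' Q : Query P C) : Prop :=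
  ∀ x ∈ Q.noncopy, ∃ y ∈ Q'.noncopy, h (.var y) = .var x

theorem isTemplateHom_id (Q : Query P C) : IsTemplateHom id Q Q where
  head := by simp
  const _ _ := rfl
  body g hg := ⟨g, hg, rfl, by simp⟩

theorem IsTemplateHom.mem_terms {h : Term C → Term C} {Q' Q : Query P C}
    (hh : IsTemplateHom h Q' Q) {t : Term C} (ht : t ∈ Q'.terms) : h t ∈ Q.terms := by
  rcases ht with ht | ⟨g, hg, ht⟩
  · exact Or.inl (hh.head ▸ List.mem_map_of_mem ht)
  · obtain ⟨k, hk, -, ha⟩ := hh.body g hg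
    exact Or.inr ⟨k, hk, ha ▸ List.mem_map_of_mem ht⟩

theorem IsTemplateHom.comp {h h' : Term C → Term C} {Q Q' Q'' : Query P C}
    (hh : IsTemplateHom h Q' Q) (hh' : IsTemplateHom h' Q'' Q') :
    IsTemplateHom (h ∘ h') Q'' Q where
  head := by rw [← List.map_map, hh'.head, hh.head]
  const c hc := by
    have hc' := hh'.const c hc
    have := hh'.mem_terms hc
    rw [hc'] at this
    rw [Function.comp_apply, hc', hh.const c this]
  body g hg := by
    obtain ⟨k, hk, hp, ha⟩ := hh'.body g hg
    obtain ⟨k', hk', hp', ha'⟩ := hh.body k hk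
    exact ⟨k', hk', hp'.trans hp, by rw [ha', ha, List.map_map]⟩

theorem IsTemplateHom.copyImage_mem {h : Term C → Term C} {Q' Q : Query P C}
    (hh : IsTemplateHom h Q' Q) (i) : Q'.copyImage h i ∈ Q.templates :=
  mem_templates.2 (hh.body _ (Q'.subgoalOf_mem i))

theorem finite_nonsetVars (Q : Query P C) : Q.nonsetVars.Finite := by
  refine Set.Finite.union ?_ (List.finite_toSet Q.noncopy)
  exact (List.finite_toSet Q.head).preimage (fun x _ y _ h => by simpa using h)

theorem finite_terms (Q : Query P C) : Q.terms.Finite := by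
  refine Set.Finite.union (List.finite_toSet Q.head) ?_
  refine (List.finite_toSet (Q.body.flatMap Subgoal.args)).subset ?_
  rintro t ⟨g, hg, ht⟩
  exact List.mem_flatMap.2 ⟨g, hg, ht⟩

/-! ### Databases blown up from a query -/

section Blowup

/-- The variable whose copy is the given constant; constants that are copies of no variable are
kept. -/
noncomputable def fold (e : ℕ × Bool → C) (c : C) : Term C :=
  open Classical in if h : ∃ p, e p = c then .var h.choose.1 else .const c

/-- The constant representing a term. -/
def unfold (e : ℕ × Bool → C) (b : Bool) : Term C → C
  | .var x => e (x, b)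
  | .const c => c

variable {arity : P → ℕ+} {Q Q' : Query P C} {e : ℕ × Bool → C}

theorem fold_apply (he : e.Injective) (p : ℕ × Bool) : fold e (e p) = .var p.1 := by
  have h : ∃ q, e q = e p := ⟨p, rfl⟩
  rw [fold, dif_pos h, he h.choose_spec]

theorem fold_of_forall_ne {c : C} (h : ∀ p, e p ≠ c) : fold e c = .const c :=
  dif_neg (by simpa using h)

theorem eq_or_eq_of_fold_eq_var (he : e.Injective) {c : C} {x : ℕ} (h : fold e c = .var x) :
    c = e (x, false) ∨ c = e (x, true) := by
  by_cases hc : ∃ p, e p = c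
  · obtain ⟨⟨y, b⟩, rfl⟩ := hc
    rw [fold_apply he] at h
    cases h
    cases b <;> simp
  · rw [fold, dif_neg hc] at h
    cases h

theorem eq_of_fold_eq_const (he : e.Injective) {c d : C} (h : fold e c = .const d) : c = d := by
  by_cases hc : ∃ p, e p = c
  · obtain ⟨p, rfl⟩ := hc
    rw [fold_apply he] at h
    cases h
  · rw [fold, dif_neg hc] at h
    cases h
    rfl

theorem finite_fold_fiber (he : e.Injective) (t : Term C) : {c | fold e c = t}.Finite := by
  cases t with
  | var x =>
    exact (Set.toFinite {e (x, false), e (x, true)}).subset fun c hc =>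
      eq_or_eq_of_fold_eq_var he hc
  | const d => exact (Set.finite_singleton d).subset fun c hc => eq_of_fold_eq_const he hc

theorem finite_map_fold_fiber (he : e.Injective) (l : List (Term C)) :
    {s : List C | s.map (fold e) = l}.Finite := by
  induction l with
  | nil => exact (Set.finite_singleton []).subset fun s hs => by simpa using hs
  | cons t l ih =>
    refine ((finite_fold_fiber he t).image2 List.cons ih).subset ?_
    rintro (_ | ⟨c, s⟩) hs
    · simp at hs
    · simp only [Set.mem_ofPred_eq, List.map_cons, List.cons.injEq] at hs
      exact ⟨c, hs.1, s, hs.2, rfl⟩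

theorem finite_templates_preimage (he : e.Injective) (Q : Query P C) :
    {a : P × List C | (a.1, a.2.map (fold e)) ∈ Q.templates}.Finite := by
  refine Set.Finite.subset (Q.templates.finite_toSet.biUnion fun τ _ =>
    (Set.finite_singleton τ.1).prod (finite_map_fold_fiber he τ.2)) ?_
  rintro ⟨p, s⟩ h
  simp only [Set.mem_iUnion]
  exact ⟨_, h, rfl, rfl⟩

/-- The ground atoms folding to a template of `Q`, in which second copies are available only for
the variables in `S`. -/
def IsBlowupAtom (Q : Query P C) (e : ℕ × Bool → C) (S : Finset ℕ) (a : P × List C) : Prop :=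
  (a.1, a.2.map (fold e)) ∈ Q.templates ∧ ∀ x, e (x, true) ∈ a.2 → x ∈ S

open Classical in
/-- The database of all ground atoms that fold to a template `τ` of `Q`, in which second copies are
available only for the variables in `S`; there are `n τ` copies of these atoms. -/
noncomputable def blowup (hQ : Q.IsCCQ arity) (he : e.Injective) (S : Finset ℕ)
    (n : P × List (Term C) → ℕ) : Database arity C where
  copies := Finsupp.onFinset (finite_templates_preimage he Q).toFinset
    (fun a => if IsBlowupAtom Q e S a then n (a.1, a.2.map (fold e)) else 0) (by
      intro a ha
      rw [Set.Finite.mem_toFinset]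
      by_contra h
      exact ha (if_neg fun h' => h h'.1))
  args_length a ha := by
    have h : IsBlowupAtom Q e S a := by
      by_contra h
      exact ha (if_neg h)
    obtain ⟨g, hg, hp, hs⟩ := mem_templates.1 h.1
    rw [← hp, ← hQ.args_length g hg, hs, List.length_map]

theorem one_le_blowup_copies_iff (hQ : Q.IsCCQ arity) (he : e.Injective) {S : Finset ℕ}
    {n : P × List (Term C) → ℕ} (hn : ∀ τ, 1 ≤ n τ) (a : P × List C) :
    1 ≤ (blowup hQ he S n).copies a ↔ IsBlowupAtom Q e S a := by
  classical
  simp only [blowup, Finsupp.onFinset_apply]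
  split <;> simp_all

theorem blowup_copies (hQ : Q.IsCCQ arity) (he : e.Injective) {S : Finset ℕ}
    {n : P × List (Term C) → ℕ} {a : P × List C} (h : IsBlowupAtom Q e S a) :
    (blowup hQ he S n).copies a = n (a.1, a.2.map (fold e)) :=
  if_pos h

theorem satisfies_blowup_iff (hQ : Q.IsCCQ arity) (he : e.Injective) {S : Finset ℕ}
    {n : P × List (Term C) → ℕ} (hn : ∀ τ, 1 ≤ n τ) (γ : Assignment C) (g : Subgoal P C) :
    γ.Satisfies (blowup hQ he S n) g ↔
      IsBlowupAtom Q e S (g.pred, g.args.map γ.eval) ∧ ∀ i, g.copy = some i →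
        1 ≤ γ.onCopy i ∧ γ.onCopy i ≤ n (g.pred, g.args.map (fold e ∘ γ.eval)) := by
  unfold Assignment.Satisfies
  split
  · next h => simp [one_le_blowup_copies_iff hQ he hn, h]
  · next i h =>
    rw [h]
    constructor
    · rintro ⟨h1, h2⟩
      have h3 := (one_le_blowup_copies_iff hQ he hn _).1 (h1.trans h2)
      rw [blowup_copies hQ he h3, List.map_map] at h2
      refine ⟨h3, ?_⟩
      rintro _ ⟨⟩
      exact ⟨h1, h2⟩
    · rintro ⟨h3, h4⟩
      rw [blowup_copies hQ he h3, List.map_map]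
      exact h4 i rfl

/-- The results of `Q'` on the blown-up database that represent the head vector of `Q`. -/
def blowupResults (Q' : Query P C) (hQ : Q.IsCCQ arity) (he : e.Injective) (S : Finset ℕ)
    (n : P × List (Term C) → ℕ) :
    Set (({x // x ∈ Q'.nonsetVars} → C) × ({i // i ∈ Q'.copyVars} → ℕ)) :=
  Q'.restrict '' {γ | γ ∈ Q'.satAssignments (blowup hQ he S n) ∧
    Q'.head.map γ.eval = Q.head.map (unfold e false)}

open Classical in
/-- The multiset noncopy variables of `Q` whose second copy is used. -/
noncomputable def hits (Q Q' : Query P C) (e : ℕ × Bool → C)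
    (ρ : ({x // x ∈ Q'.nonsetVars} → C) × ({i // i ∈ Q'.copyVars} → ℕ)) : Finset ℕ :=
  Q.noncopy.toFinset.filter fun x => ∃ y, ρ.1 y = e (x, true)

theorem mem_hits {ρ : ({x // x ∈ Q'.nonsetVars} → C) × ({i // i ∈ Q'.copyVars} → ℕ)} {x : ℕ} :
    x ∈ hits Q Q' e ρ ↔ x ∈ Q.noncopy ∧ ∃ y, ρ.1 y = e (x, true) := by
  simp only [hits, Finset.mem_filter, List.mem_toFinset]

/-- No constant of `Q` represents a variable. -/
def IsFresh (e : ℕ × Bool → C) (Q : Query P C) : Prop :=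
  ∀ c, Term.const c ∈ Q.terms → ∀ p, e p ≠ c

theorem IsFresh.ne_unfold (he : e.Injective) (hf : IsFresh e Q) {t : Term C} (ht : t ∈ Q.terms)
    (x : ℕ) : e (x, true) ≠ unfold e false t := by
  cases t with
  | var y => exact fun h => by simpa using he h
  | const c => exact hf c ht _

theorem IsFresh.fold_unfold (he : e.Injective) (hf : IsFresh e Q) {t : Term C} (ht : t ∈ Q.terms)
    (b : Bool) : fold e (unfold e b t) = t := by
  cases t with
  | var y => exact fold_apply he _
  | const c => exact fold_of_forall_ne (hf c ht)

open Classical in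
/-- Replaces second copies of variables outside `S` by first copies. -/
noncomputable def retract (e : ℕ × Bool → C) (S : Finset ℕ) (c : C) : C :=
  if h : ∃ x, x ∉ S ∧ c = e (x, true) then e (h.choose, false) else c

theorem fold_retract (he : e.Injective) (S : Finset ℕ) (c : C) :
    fold e (retract e S c) = fold e c := by
  unfold retract
  split
  · next h =>
    rw [fold_apply he]
    conv_rhs => rw [h.choose_spec.2, fold_apply he]
  · rfl

theorem retract_eq_self {S : Finset ℕ} {c : C} (h : ∀ x, c = e (x, true) → x ∈ S) :
    retract e S c = c :=
  dif_neg fun ⟨x, hx, hc⟩ => hx (h x hc)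

theorem mem_of_retract_eq (he : e.Injective) {S : Finset ℕ} {c : C} {x : ℕ}
    (h : retract e S c = e (x, true)) : x ∈ S := by
  unfold retract at h
  split at h
  · simpa using he h
  · next h' =>
    by_contra hx
    exact h' ⟨x, hx, h⟩

/-- Restricting the database to `S` is the same as restricting the results: set variables using
second constants outside `S` can be moved to first constants, which changes neither the folded
templates nor the result. -/
theorem blowupResults_eq (hQ : Q.IsCCQ arity) (hQ' : Q'.IsCCQ arity) (he : e.Injective)
    (hf' : IsFresh e Q') {n : P × List (Term C) → ℕ} (hn : ∀ τ, 1 ≤ n τ)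
    {S : Finset ℕ} (hS : S ⊆ Q.noncopy.toFinset) :
    blowupResults Q' hQ he S n =
      {ρ ∈ blowupResults Q' hQ he Q.noncopy.toFinset n | hits Q Q' e ρ ⊆ S} := by
  ext ρ
  constructor
  · rintro ⟨γ, ⟨hγ, ht⟩, rfl⟩
    have hγ' := fun g hg => (satisfies_blowup_iff hQ he hn γ g).1 (hγ g hg)
    refine ⟨⟨γ, ⟨fun g hg => (satisfies_blowup_iff hQ he hn γ g).2
      ⟨⟨(hγ' g hg).1.1, fun x hx => hS ((hγ' g hg).1.2 x hx)⟩, (hγ' g hg).2⟩, ht⟩, rfl⟩, ?_⟩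
    intro x hx
    obtain ⟨-, y, hy⟩ := mem_hits.1 hx
    obtain ⟨g, hg, hyg⟩ := mem_terms_of_mem_nonsetVars hQ' y.2
    exact (hγ' g hg).1.2 x (List.mem_map.2 ⟨_, hyg, hy⟩)
  · rintro ⟨⟨γ, ⟨hγ, ht⟩, rfl⟩, hh⟩
    have hγ' := fun g hg => (satisfies_blowup_iff hQ he hn γ g).1 (hγ g hg)
    let γ' : Assignment C := ⟨fun x => retract e S (γ.onVar x), γ.onCopy⟩
    have heval : ∀ t ∈ Q'.terms, γ'.eval t = retract e S (γ.eval t) := by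
      intro t ht
      cases t with
      | var x => rfl
      | const c => exact (retract_eq_self fun x hx => absurd hx.symm (hf' c ht _)).symm
    -- A second constant taken by a nonset variable is a hit, hence belongs to `S` and is not moved.
    have hnonset : ∀ x ∈ Q'.nonsetVars, retract e S (γ.onVar x) = γ.onVar x := by
      intro x hx
      refine retract_eq_self fun y hy => hh (mem_hits.2 ⟨List.mem_toFinset.1 ?_, ⟨x, hx⟩, hy⟩)
      obtain ⟨g, hg, hxg⟩ := mem_terms_of_mem_nonsetVars hQ' hx
      exact (hγ' g hg).1.2 y (List.mem_map.2 ⟨_, hxg, hy⟩)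
    have hfold : ∀ g ∈ Q'.body, g.args.map (fold e ∘ γ'.eval) = g.args.map (fold e ∘ γ.eval) :=
      fun g hg => List.map_congr_left fun t ht => by
        rw [Function.comp_apply, heval t (Or.inr ⟨g, hg, ht⟩), fold_retract he]; rfl
    refine ⟨γ', ⟨fun g hg => (satisfies_blowup_iff hQ he hn γ' g).2 ⟨⟨?_, ?_⟩, ?_⟩, ?_⟩, ?_⟩
    · have := (hγ' g hg).1.1
      simp only [List.map_map] at this ⊢
      rwa [hfold g hg]
    · intro x hx
      obtain ⟨t, ht, hx⟩ := List.mem_map.1 hx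
      rw [heval t (Or.inr ⟨g, hg, ht⟩)] at hx
      exact mem_of_retract_eq he hx
    · rw [hfold g hg]
      exact (hγ' g hg).2
    · rw [← ht]
      refine List.map_congr_left fun t ht => ?_
      rw [heval t (Or.inl ht)]
      cases t with
      | var x => exact hnonset x (Or.inl ht)
      | const c => exact retract_eq_self fun x hx => absurd hx.symm (hf' c (Or.inl ht) _)
    · exact Prod.ext (funext fun x => hnonset x.1 x.2) rfl

theorem isTemplateHom_fold (hQ : Q.IsCCQ arity) (he : e.Injective)
    (hf : IsFresh e Q) (hf' : IsFresh e Q') {n : P × List (Term C) → ℕ} (hn : ∀ τ, 1 ≤ n τ)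
    {S : Finset ℕ} {γ : Assignment C} (hγ : γ ∈ Q'.satAssignments (blowup hQ he S n))
    (ht : Q'.head.map γ.eval = Q.head.map (unfold e false)) :
    IsTemplateHom (fold e ∘ γ.eval) Q' Q where
  head := by
    rw [← List.map_map, ht, List.map_map]
    exact (List.map_congr_left fun t ht => hf.fold_unfold he (Or.inl ht) _).trans (List.map_id _)
  const c hc := fold_of_forall_ne (hf' c hc)
  body g hg := by
    have := ((satisfies_blowup_iff hQ he hn γ g).1 (hγ g hg)).1.1
    rw [List.map_map] at this
    exact mem_templates.1 this

theorem coversNoncopy_fold (he : e.Injective)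
    (hf : IsFresh e Q) {γ : Assignment C}
    (ht : Q'.head.map γ.eval = Q.head.map (unfold e false))
    (hh : hits Q Q' e (Q'.restrict γ) = Q.noncopy.toFinset) :
    CoversNoncopy (fold e ∘ γ.eval) Q' Q := by
  intro x hx
  obtain ⟨-, ⟨y, hy⟩, hxy⟩ := mem_hits.1 (hh.symm.subset (List.mem_toFinset.2 hx))
  change γ.onVar y = _ at hxy
  refine ⟨y, hy.resolve_left fun hy => ?_, ?_⟩
  -- The variable taking the second constant is not distinguished, because the output tuple contains
  -- only first constants and constants of `Q`.
  · have := List.mem_map_of_mem (f := γ.eval) hy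
    rw [ht] at this
    obtain ⟨t, ht, h⟩ := List.mem_map.1 this
    exact hf.ne_unfold he (Or.inl ht) x (hxy.symm.trans h.symm)
  · change fold e (γ.onVar y) = _
    rw [hxy, fold_apply he]

end Blowup

end Query

/-! ### Counting results on blown-up databases -/

namespace Query

section Blowup

variable {P C : Type*} {arity : P → ℕ+} {Q Q' Q₁ Q₂ : Query P C} {e : ℕ × Bool → C}

theorem finite_values (he : e.Injective) (Q : Query P C) : {c | fold e c ∈ Q.terms}.Finite := by
  refine (Q.finite_terms.biUnion fun t _ => finite_fold_fiber he t).subset fun c hc => ?_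
  simp only [Set.mem_iUnion]
  exact ⟨_, hc, rfl⟩

noncomputable instance (Q : Query P C) : Fintype {x // x ∈ Q.nonsetVars} :=
  (finite_nonsetVars Q).fintype

open Classical in
/-- Pairs of values of the regular nonset variables and of images of the copy-sensitive
subgoals, among which the results on a blown-up database are to be found. -/
noncomputable def resultShapes (Q' : Query P C) (he : e.Injective) (Q : Query P C) :
    Finset (({x // x ∈ Q'.nonsetVars} → C) × ({i // i ∈ Q'.copyVars} → P × List (Term C))) :=
  Fintype.piFinset (fun _ => (finite_values he Q).toFinset) ×ˢ
    Fintype.piFinset (fun _ => Q.templates)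

open Classical in
/-- The results of a given shape. -/
noncomputable def shapeResults {Q' : Query P C} (n : P × List (Term C) → ℕ)
    (s : ({x // x ∈ Q'.nonsetVars} → C) × ({i // i ∈ Q'.copyVars} → P × List (Term C))) :
    Finset (({x // x ∈ Q'.nonsetVars} → C) × ({i // i ∈ Q'.copyVars} → ℕ)) :=
  {s.1} ×ˢ Fintype.piFinset (fun i => Finset.Icc 1 (n (s.2 i)))

theorem card_shapeResults (n : P × List (Term C) → ℕ)
    (s : ({x // x ∈ Q'.nonsetVars} → C) × ({i // i ∈ Q'.copyVars} → P × List (Term C))) :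
    (shapeResults n s).card = ∏ i, n (s.2 i) := by
  simp [shapeResults]

/-- Folding a satisfying assignment gives the homomorphism. The point is that `resultShapes` does
not involve `n`: only the ranges of the copy variables do. -/
theorem exists_shape (hQ : Q.IsCCQ arity) (hQ' : Q'.IsCCQ arity) (he : e.Injective)
    (hf : IsFresh e Q) (hf' : IsFresh e Q') {n : P × List (Term C) → ℕ} (hn : ∀ τ, 1 ≤ n τ)
    {S : Finset ℕ} {ρ} (hρ : ρ ∈ blowupResults Q' hQ he S n) :
    ∃ h, IsTemplateHom h Q' Q ∧
      (hits Q Q' e ρ = Q.noncopy.toFinset → CoversNoncopy h Q' Q) ∧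
      (ρ.1, Q'.copyImage h) ∈ resultShapes Q' he Q ∧
      ρ ∈ shapeResults n (ρ.1, Q'.copyImage h) := by
  obtain ⟨γ, ⟨hγ, ht⟩, rfl⟩ := hρ
  have hom := isTemplateHom_fold hQ he hf hf' hn hγ ht
  refine ⟨_, hom, coversNoncopy_fold he hf ht, ?_, ?_⟩
  · simp only [resultShapes, Finset.mem_product, Fintype.mem_piFinset, Set.Finite.mem_toFinset]
    refine ⟨fun x => ?_, hom.copyImage_mem⟩
    obtain ⟨g, hg, hx⟩ := mem_terms_of_mem_nonsetVars hQ' x.2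
    exact hom.mem_terms (Or.inr ⟨g, hg, hx⟩)
  · simp only [shapeResults, Finset.mem_product, Finset.mem_singleton, Fintype.mem_piFinset,
      Finset.mem_Icc, true_and]
    intro i
    exact ((satisfies_blowup_iff hQ he hn γ _).1 (hγ _ (Q'.subgoalOf_mem i))).2 i.1
      (Q'.subgoalOf_copy i)

theorem finite_blowupResults (hQ : Q.IsCCQ arity) (hQ' : Q'.IsCCQ arity) (he : e.Injective)
    (hf : IsFresh e Q) (hf' : IsFresh e Q') {n : P × List (Term C) → ℕ} (hn : ∀ τ, 1 ≤ n τ)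
    (S : Finset ℕ) : (blowupResults Q' hQ he S n).Finite := by
  classical
  refine ((resultShapes Q' he Q).biUnion (shapeResults n)).finite_toSet.subset fun ρ hρ => ?_
  obtain ⟨h, -, -, h1, h2⟩ := exists_shape hQ hQ' he hf hf' hn hρ
  exact Finset.mem_coe.2 (Finset.mem_biUnion.2 ⟨_, h1, h2⟩)

/-- The number of results that use the second copies of all multiset noncopy variables. -/
noncomputable def coveringCount (Q' : Query P C) (hQ : Q.IsCCQ arity) (he : e.Injective)
    (n : P × List (Term C) → ℕ) : ℕ :=
  {ρ ∈ blowupResults Q' hQ he Q.noncopy.toFinset n | hits Q Q' e ρ = Q.noncopy.toFinset}.ncard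

/-- By `blowupResults_eq`, equivalence on the databases for all `S` equates the numbers of results
with hits inside `S`; inversion then equates the numbers with hits exactly the full set. -/
theorem coveringCount_eq (hQ : Q.IsCCQ arity) (hQ₁ : Q₁.IsCCQ arity) (hQ₂ : Q₂.IsCCQ arity)
    (he : e.Injective) (hf : IsFresh e Q) (hf₁ : IsFresh e Q₁) (hf₂ : IsFresh e Q₂)
    {n : P × List (Term C) → ℕ} (hn : ∀ τ, 1 ≤ n τ) (h : EquivC arity Q₁ Q₂) :
    coveringCount Q₁ hQ he n = coveringCount Q₂ hQ he n := by
  classical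
  set U := Q.noncopy.toFinset
  have f₁ := finite_blowupResults hQ hQ₁ he hf hf₁ hn U
  have f₂ := finite_blowupResults hQ hQ₂ he hf hf₂ hn U
  have := Finset.card_filter_eq_of_card_filter_subset f₁.toFinset f₂.toFinset
    (hits Q Q₁ e) (hits Q Q₂ e) U (fun S hS => ?_) U subset_rfl
  · rw [← Set.ncard_coe_finset, ← Set.ncard_coe_finset] at this
    simpa [coveringCount] using this
  · have h' : (blowupResults Q₁ hQ he S n).encard = (blowupResults Q₂ hQ he S n).encard :=
      le_antisymm (h.1 _ _) (h.2 _ _)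
    rw [blowupResults_eq hQ hQ₁ he hf₁ hn hS, blowupResults_eq hQ hQ₂ he hf₂ hn hS] at h'
    rw [← Set.ncard_coe_finset, ← Set.ncard_coe_finset]
    simpa [Set.ncard] using congrArg ENat.toNat h'

theorem coveringCount_le (hQ : Q.IsCCQ arity) (hQ' : Q'.IsCCQ arity) (he : e.Injective)
    (hf : IsFresh e Q) (hf' : IsFresh e Q') {n : P × List (Term C) → ℕ} (hn : ∀ τ, 1 ≤ n τ)
    {B : ℕ} (hB : ∀ h, IsTemplateHom h Q' Q → CoversNoncopy h Q' Q →
      ∏ i, n (Q'.copyImage h i) ≤ B) :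
    coveringCount Q' hQ he n ≤ (resultShapes Q' he Q).card * B := by
  classical
  set Φ := (resultShapes Q' he Q).filter fun s => ∃ h, IsTemplateHom h Q' Q ∧
    CoversNoncopy h Q' Q ∧ s.2 = Q'.copyImage h
  have hsub : {ρ ∈ blowupResults Q' hQ he Q.noncopy.toFinset n |
      hits Q Q' e ρ = Q.noncopy.toFinset} ⊆ ↑(Φ.biUnion (shapeResults n)) := by
    rintro ρ ⟨hρ, hh⟩
    obtain ⟨h, h0, hc, h1, h2⟩ := exists_shape hQ hQ' he hf hf' hn hρ
    exact Finset.mem_coe.2 (Finset.mem_biUnion.2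
      ⟨_, Finset.mem_filter.2 ⟨h1, h, h0, hc hh, rfl⟩, h2⟩)
  calc coveringCount Q' hQ he n ≤ (Φ.biUnion (shapeResults n)).card := by
        rw [← Set.ncard_coe_finset]
        exact Set.ncard_le_ncard hsub (Finset.finite_toSet _)
    _ ≤ Φ.card * B := by
        refine Finset.card_biUnion_le_card_mul _ _ _ fun s hs => ?_
        obtain ⟨-, h, h0, hc, h1⟩ := Finset.mem_filter.1 hs
        rw [card_shapeResults, h1]
        exact hB h h0 hc
    _ ≤ _ := Nat.mul_le_mul_right _ (Finset.card_filter_le _ _)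

theorem le_coveringCount (hQ : Q.IsCCQ arity) (hQ' : Q'.IsCCQ arity) (he : e.Injective)
    (hf : IsFresh e Q) (hf' : IsFresh e Q') {n : P × List (Term C) → ℕ} (hn : ∀ τ, 1 ≤ n τ)
    {h : Term C → Term C} (hh : IsTemplateHom h Q' Q) (hc : CoversNoncopy h Q' Q) :
    ∏ i, n (Q'.copyImage h i) ≤ coveringCount Q' hQ he n := by
  classical
  -- Second constants represent exactly the multiset noncopy variables of `Q`: a covering `h` then
  -- hits them all, and the head, which avoids them, gets first constants.
  let val : Term C → C := fun t => unfold e (decide (t ∈ Q.noncopyTerms)) t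
  let γ : ({i // i ∈ Q'.copyVars} → ℕ) → Assignment C := fun m =>
    ⟨fun x => val (h (.var x)), fun i => if hi : i ∈ Q'.copyVars then m ⟨i, hi⟩ else 0⟩
  have heval : ∀ m, ∀ t ∈ Q'.terms, (γ m).eval t = val (h t) := by
    intro m t ht
    cases t with
    | var x => rfl
    | const c => rw [hh.const c ht]; rfl
  have hfold : ∀ m, ∀ t ∈ Q'.terms, (fold e ∘ (γ m).eval) t = h t := by
    intro m t ht
    rw [Function.comp_apply, heval m t ht]
    exact hf.fold_unfold he (hh.mem_terms ht) _
  have hvar : ∀ x, Term.var x ∈ Q.noncopyTerms ↔ x ∈ Q.noncopy := by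
    simp [noncopyTerms]
  have hval : ∀ t ∈ Q.terms, ∀ x, e (x, true) = val t → x ∈ Q.noncopy := by
    intro t ht x hx
    cases t with
    | var y =>
      obtain ⟨rfl, h1⟩ := Prod.mk.inj (he hx)
      exact (hvar x).1 (of_decide_eq_true h1.symm)
    | const c => exact absurd hx (hf c ht _)
  have hcard : (Fintype.piFinset fun i => Finset.Icc 1 (n (Q'.copyImage h i))).card =
      ∏ i, n (Q'.copyImage h i) := by simp
  rw [← hcard, ← Set.ncard_coe_finset]
  refine Set.ncard_le_ncard_of_injOn (fun m => Q'.restrict (γ m)) ?_ ?_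
    ((finite_blowupResults hQ hQ' he hf hf' hn _).subset fun _ h => h.1)
  · intro m hm
    simp only [Finset.mem_coe, Fintype.mem_piFinset, Finset.mem_Icc] at hm
    refine ⟨⟨γ m, ⟨fun g hg => (satisfies_blowup_iff hQ he hn _ g).2 ⟨⟨?_, ?_⟩, ?_⟩, ?_⟩, rfl⟩,
      ?_⟩
    · obtain ⟨k, hk, hp, ha⟩ := hh.body g hg
      refine mem_templates.2 ⟨k, hk, hp, ?_⟩
      rw [ha, List.map_map]
      exact (List.map_congr_left fun t ht => hfold m t (Or.inr ⟨g, hg, ht⟩)).symm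
    · intro x hx
      obtain ⟨t, ht, hx⟩ := List.mem_map.1 hx
      have htm : t ∈ Q'.terms := Or.inr ⟨g, hg, ht⟩
      rw [heval m t htm] at hx
      exact List.mem_toFinset.2 (hval _ (hh.mem_terms htm) x hx.symm)
    · intro i hi
      have hi' : i ∈ Q'.copyVars := mem_copyVars.2 ⟨g, hg, hi⟩
      have := hm ⟨i, hi'⟩
      rw [copyImage, subgoalOf_eq hQ'.copyVars_nodup hg hi] at this
      rw [List.map_congr_left fun t ht => hfold m t (Or.inr ⟨g, hg, ht⟩)]
      simpa only [γ, dif_pos hi'] using this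
    · rw [← hh.head, List.map_map]
      refine List.map_congr_left fun t ht => ?_
      rw [heval m t (Or.inl ht)]
      have : h t ∉ Q.noncopyTerms := by
        rintro ⟨x, hx, hxt⟩
        refine hQ.noncopy_nondistinguished x hx ?_
        rw [← hxt, ← hh.head]
        exact List.mem_map_of_mem ht
      simp [val, this]
    · ext x
      rw [mem_hits, List.mem_toFinset]
      refine ⟨fun h => h.1, fun hx => ⟨hx, ?_⟩⟩
      obtain ⟨y, hy, hyx⟩ := hc x hx
      refine ⟨⟨y, Or.inr hy⟩, ?_⟩
      simp only [restrict, γ, hyx, val, hvar, hx, decide_true, unfold]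
  · intro m _ m' _ hmm
    funext i
    have := congrFun (congrArg Prod.snd hmm) i
    have hi := i.2
    simpa [restrict, γ, hi] using this

/-- Take `n τ = (K + 1) ^ w τ`, where `K` bounds the number of shapes for `Q₂`. If every covering
homomorphism from `Q₂` had weight below `E`, the common count would be at least `(K + 1) ^ E` but at
most `K * (K + 1) ^ (E - 1)`. -/
theorem exists_hom_weight_le (hQ : Q.IsCCQ arity) (hQ₁ : Q₁.IsCCQ arity) (hQ₂ : Q₂.IsCCQ arity)
    (he : e.Injective) (hf : IsFresh e Q) (hf₁ : IsFresh e Q₁) (hf₂ : IsFresh e Q₂)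
    (h : EquivC arity Q₁ Q₂) (w : P × List (Term C) → ℕ) {f : Term C → Term C}
    (hom : IsTemplateHom f Q₁ Q) (hc : CoversNoncopy f Q₁ Q) :
    ∃ g, IsTemplateHom g Q₂ Q ∧ CoversNoncopy g Q₂ Q ∧
      ∑ i, w (Q₁.copyImage f i) ≤ ∑ i, w (Q₂.copyImage g i) := by
  by_contra! hcon
  set K := (resultShapes Q₂ he Q).card
  set E := ∑ i, w (Q₁.copyImage f i)
  have hn : ∀ τ, 1 ≤ (K + 1) ^ w τ := fun τ => Nat.one_le_pow _ _ K.succ_pos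
  have h1 := le_coveringCount hQ hQ₁ he hf hf₁ hn hom hc
  rw [coveringCount_eq hQ hQ₁ hQ₂ he hf hf₁ hf₂ hn h, Finset.prod_pow_eq_pow_sum] at h1
  change (K + 1) ^ E ≤ _ at h1
  -- For `E = 0` the assumption excludes every covering homomorphism from `Q₂`, so the count
  -- vanishes; this case avoids the truncated `E - 1`.
  rcases Nat.eq_zero_or_pos E with hE | hE
  · have h2 := coveringCount_le hQ hQ₂ he hf hf₂ hn (B := 0) fun g hg hg' =>
      absurd (hcon g hg hg') (by omega)
    have h3 : 0 < (K + 1) ^ E := by positivity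
    omega
  · have h2 := coveringCount_le hQ hQ₂ he hf hf₂ hn (B := (K + 1) ^ (E - 1)) fun g hg hg' => by
      rw [Finset.prod_pow_eq_pow_sum]
      exact Nat.pow_le_pow_right K.succ_pos (by have := hcon g hg hg'; omega)
    have h3 : (K + 1) ^ E = K * (K + 1) ^ (E - 1) + (K + 1) ^ (E - 1) := by
      conv_lhs => rw [← Nat.sub_add_cancel hE, pow_succ]
      ring
    have h4 : 0 < (K + 1) ^ (E - 1) := by positivity
    have h5 : _ ≤ K * (K + 1) ^ (E - 1) := h1.trans h2
    omega

end Blowup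

end Query

namespace Query

variable {P C : Type*} {arity : P → ℕ+} {Q Q' : Query P C}

/-! ### Explicit-wave queries -/

theorem lt_freshCopy {i : ℕ} (hi : i ∈ Q.copyVars) : i < Q.freshCopy := by
  have : ∀ l : List ℕ, i ∈ l → i ≤ l.foldr max 0 := by
    intro l
    induction l with
    | nil => simp
    | cons a l ih =>
      intro h
      rcases List.mem_cons.1 h with rfl | h
      · exact le_max_left _ _
      · exact (ih h).trans (le_max_right _ _)
  exact Nat.lt_succ_of_le (this _ hi)

theorem mem_copyEnhanced_body {g : Subgoal P C} :
    g ∈ Q.copyEnhanced.body ↔ ∃ k, ∃ h : k < Q.body.length,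
      g = { Q.body[k] with copy := some (Q.body[k].copy.getD (Q.freshCopy + k)) } := by
  simp only [copyEnhanced, List.mem_mapIdx]
  exact exists_congr fun k => exists_congr fun h => eq_comm

theorem exists_of_mem_copyEnhanced_body {g : Subgoal P C} (hg : g ∈ Q.copyEnhanced.body) :
    ∃ k ∈ Q.body, k.pred = g.pred ∧ k.args = g.args := by
  obtain ⟨k, hk, rfl⟩ := mem_copyEnhanced_body.1 hg
  exact ⟨_, List.getElem_mem hk, rfl, rfl⟩

theorem exists_mem_copyEnhanced_body {g : Subgoal P C} (hg : g ∈ Q.body) :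
    ∃ i, Subgoal.mk g.pred g.args (some i) ∈ Q.copyEnhanced.body := by
  obtain ⟨k, hk, rfl⟩ := List.getElem_of_mem hg
  exact ⟨_, mem_copyEnhanced_body.2 ⟨k, hk, rfl⟩⟩

theorem eq_of_mem_copyEnhanced_body (hQ : Q.copyVars.Nodup) {g g' : Subgoal P C} {i : ℕ}
    (hg : g ∈ Q.copyEnhanced.body) (hg' : g' ∈ Q.copyEnhanced.body)
    (h : g.copy = some i) (h' : g'.copy = some i) : g = g' := by
  obtain ⟨k, hk, rfl⟩ := mem_copyEnhanced_body.1 hg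
  obtain ⟨l, hl, rfl⟩ := mem_copyEnhanced_body.1 hg'
  have hlt : ∀ m (hm : m < Q.body.length) j, Q.body[m].copy = some j → j < Q.freshCopy :=
    fun m hm j hj => lt_freshCopy (mem_copyVars.2 ⟨_, List.getElem_mem hm, hj⟩)
  simp only [Option.some.injEq] at h h'
  rcases hk' : Q.body[k].copy with _ | a <;> rcases hl' : Q.body[l].copy with _ | b <;>
    simp only [hk', hl', Option.getD_none, Option.getD_some] at h h'
  · obtain rfl : k = l := by omega
    rfl
  · have := hlt l hl b hl'
    omega
  · have := hlt k hk a hk'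
    omega
  · have := eq_of_copy_eq hQ (List.getElem_mem hk) (List.getElem_mem hl) hk' (by rw [hl', h', h])
    subst h h'
    simp [this]

/-- After copy enhancement every subgoal has a copy variable that determines it, so each copy
variable can be sent to that of any subgoal with the image template. -/
theorem IsTemplateHom.exists_gcm (hQ : Q.copyVars.Nodup) {h : Term C → Term C}
    (hh : IsTemplateHom h Q Q) :
    ∃ c : ℕ → ℕ, (Mapping.mk h c).IsGCM Q.copyEnhanced Q.copyEnhanced := by
  have hterms : Q.copyEnhanced.terms = Q.terms := by
    ext t
    refine or_congr Iff.rfl ⟨?_, ?_⟩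
    · rintro ⟨g, hg, ht⟩
      obtain ⟨k, hk, -, ha⟩ := exists_of_mem_copyEnhanced_body hg
      exact ⟨k, hk, ha ▸ ht⟩
    · rintro ⟨g, hg, ht⟩
      obtain ⟨i, hi⟩ := exists_mem_copyEnhanced_body hg
      exact ⟨_, hi, ht⟩
  have key : ∀ i, ∃ j, ∀ g ∈ Q.copyEnhanced.body, g.copy = some i →
      Subgoal.mk g.pred (g.args.map h) (some j) ∈ Q.copyEnhanced.body := by
    intro i
    by_cases hi : ∃ g ∈ Q.copyEnhanced.body, g.copy = some i
    · obtain ⟨g, hg, hgi⟩ := hi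
      obtain ⟨k, hk, hp, ha⟩ := exists_of_mem_copyEnhanced_body hg
      obtain ⟨k', hk', hp', ha'⟩ := hh.body k hk
      obtain ⟨j, hj⟩ := exists_mem_copyEnhanced_body hk'
      refine ⟨j, fun g' hg' hgi' => ?_⟩
      rw [eq_of_mem_copyEnhanced_body hQ hg' hg hgi' hgi, ← hp, ← ha, ← hp', ← ha']
      exact hj
    · exact ⟨0, fun g hg hgi => absurd ⟨g, hg, hgi⟩ hi⟩
  choose c hc using key
  refine ⟨c, ⟨?_, ?_, hh.head, ?_, ?_⟩⟩
  · intro t ht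
    rw [hterms] at ht ⊢
    exact hh.mem_terms ht
  · intro i hi
    obtain ⟨g, hg, hgi⟩ := mem_copyVars.1 hi
    exact mem_copyVars.2 ⟨_, hc i g hg hgi, rfl⟩
  · intro a ha
    rw [hterms] at ha
    exact hh.const a ha
  · intro g hg
    obtain ⟨k, hk, rfl⟩ := mem_copyEnhanced_body.1 hg
    exact hc _ _ hg rfl

theorem IsTemplateHom.iterate {h : Term C → Term C} (hh : IsTemplateHom h Q Q) (m : ℕ) :
    IsTemplateHom h^[m] Q Q := by
  induction m with
  | zero => exact isTemplateHom_id Q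
  | succ m ih => exact ih.comp hh

/-- A choice of preimages under `h` is injective on a finite set, hence a permutation `σ`; `h^[k]`
undoes `σ ^ k`, and `k` is taken to be the order of `σ`. -/
theorem CoversNoncopy.exists_iterate_eq {h : Term C → Term C} (hc : CoversNoncopy h Q Q) :
    ∃ m, 0 < m ∧ ∀ x ∈ Q.noncopy, h^[m] (.var x) = .var x := by
  choose! r hr hhr using hc
  let f : {x // x ∈ Q.noncopy} → {x // x ∈ Q.noncopy} := fun x => ⟨r x.1, hr x.1 x.2⟩
  have hf : f.Injective := by
    intro x y hxy
    have hxy' : r x.1 = r y.1 := congrArg Subtype.val hxy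
    have h1 := hhr x.1 x.2
    rw [hxy', hhr y.1 y.2] at h1
    exact Subtype.ext (Term.var.inj h1).symm
  let σ : Equiv.Perm {x // x ∈ Q.noncopy} :=
    Equiv.ofBijective f (Finite.injective_iff_bijective.1 hf)
  have hσ : ∀ (k : ℕ) (x : {x // x ∈ Q.noncopy}), h^[k] (.var ((σ ^ k) x).1) = .var x.1 := by
    intro k
    induction k with
    | zero => intro x; rfl
    | succ k ih =>
      intro x
      rw [Function.iterate_succ_apply, pow_succ', Equiv.Perm.mul_apply]
      have : h (.var (σ ((σ ^ k) x)).1) = .var ((σ ^ k) x).1 := hhr _ ((σ ^ k) x).2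
      rw [this, ih]
  refine ⟨orderOf σ, orderOf_pos σ, fun x hx => ?_⟩
  have := hσ (orderOf σ) ⟨x, hx⟩
  rwa [pow_orderOf_eq_one] at this

/-- Some power of `h` fixes the multiset noncopy variables, so the explicit-wave condition compares
it with the identity: it fixes the templates of all copy-sensitive subgoals. Templates merged by `h`
are merged by this power, hence were equal. -/
theorem ExplicitWave.copyImage_id_eq (hw : Q.ExplicitWave) (hQ : Q.IsCCQ arity)
    {h : Term C → Term C} (hh : IsTemplateHom h Q Q) (hc : CoversNoncopy h Q Q)
    {i j : {i // i ∈ Q.copyVars}} (hij : Q.copyImage h i = Q.copyImage h j) :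
    Q.copyImage id i = Q.copyImage id j := by
  rcases hw with hw | hw
  · obtain ⟨i, hi⟩ := i
    obtain ⟨j, hj⟩ := j
    obtain ⟨a, ha⟩ | ha : (∃ a, Q.copyVars = [a]) ∨ Q.copyVars = [] := by
      rcases hq : Q.copyVars with _ | ⟨a, _ | ⟨b, l⟩⟩
      · exact Or.inr rfl
      · exact Or.inl ⟨a, rfl⟩
      · simp [hq] at hw
    · have : i = j := by
        rw [ha] at hi hj
        rw [List.mem_singleton.1 hi, List.mem_singleton.1 hj]
      subst this
      rfl
    · simp [ha] at hi
  · obtain ⟨m, hm, hfix⟩ := hc.exists_iterate_eq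
    obtain ⟨c, hc₁⟩ := (hh.iterate m).exists_gcm hQ.copyVars_nodup
    obtain ⟨d, hd₁⟩ := (isTemplateHom_id Q).exists_gcm hQ.copyVars_nodup
    have hEq : Set.EqOn h^[m] id Q.noncopyTerms := by
      rintro _ ⟨x, hx, rfl⟩
      exact hfix x hx
    have key := hw ⟨h^[m], c⟩ ⟨id, d⟩ ⟨hc₁, (Set.bijOn_id _).congr hEq.symm⟩
      ⟨hd₁, Set.bijOn_id _⟩ hEq
    have hkey : ∀ i, (Q.subgoalOf i).args.map h^[m] = (Q.subgoalOf i).args.map id := fun i =>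
      key _ (Q.subgoalOf_mem i) (by rw [Q.subgoalOf_copy i]; rfl)
    obtain ⟨hp, ha⟩ := Prod.mk.inj hij
    refine Prod.ext hp ?_
    change (Q.subgoalOf i).args.map id = (Q.subgoalOf j).args.map id
    have hms : h^[m] = h^[m - 1] ∘ h := by
      rw [← Function.iterate_succ, Nat.succ_eq_add_one, Nat.sub_add_cancel hm]
    rw [← hkey i, ← hkey j, hms, ← List.map_map, ← List.map_map]
    exact congrArg _ ha

/-- Equal multiplicities provide a bijection of copy variables that respects templates; it serves as
the copy part of the CVM. -/
theorem exists_isCVM_of_fiberCard_eq [DecidableEq (P × List (Term C))] (hQ' : Q'.IsCCQ arity)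
    {h : Term C → Term C} (hh : IsTemplateHom h Q' Q) (hc : CoversNoncopy h Q' Q)
    (hcard : ∀ τ, fiberCard (Q'.copyImage h) τ = fiberCard (Q.copyImage id) τ) :
    ∃ μ : Mapping C, μ.IsCVM Q' Q := by
  obtain ⟨σ, hσ⟩ := exists_equiv_of_fiberCard_eq _ _ hcard
  have hval : ∀ i (hi : i ∈ Q'.copyVars),
      (fun i => if hi : i ∈ Q'.copyVars then (σ ⟨i, hi⟩).1 else 0) i = (σ ⟨i, hi⟩).1 :=
    fun i hi => dif_pos hi
  refine ⟨⟨h, fun i => if hi : i ∈ Q'.copyVars then (σ ⟨i, hi⟩).1 else 0⟩,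
    fun t ht => hh.mem_terms ht, ?_, hh.const, hh.head, ?_, ?_, fun g hg _ => hh.body g hg, ?_⟩
  · intro i hi
    exact Eq.subst (motive := (· ∈ Q.copyVars)) (hval i hi).symm (σ ⟨i, hi⟩).2
  · ext j
    constructor
    · rintro ⟨i, hi, rfl⟩
      exact Eq.subst (motive := (· ∈ Q.copyVars)) (hval i hi).symm (σ ⟨i, hi⟩).2
    · intro hj
      refine ⟨(σ.symm ⟨j, hj⟩).1, (σ.symm ⟨j, hj⟩).2, ?_⟩
      exact (hval _ (σ.symm ⟨j, hj⟩).2).trans (by simp)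
  · rintro _ ⟨x, hx, rfl⟩
    obtain ⟨y, hy, hyx⟩ := hc x hx
    exact ⟨_, ⟨y, hy, rfl⟩, hyx⟩
  · intro g hg i hi
    have hi' : i ∈ Q'.copyVars := mem_copyVars.2 ⟨g, hg, hi⟩
    have := hσ ⟨i, hi'⟩
    simp only [copyImage, List.map_id, subgoalOf_eq hQ'.copyVars_nodup hg hi, Prod.mk.injEq] at this
    refine ⟨_, Q.subgoalOf_mem (σ ⟨i, hi'⟩), this.1, this.2, ?_⟩
    rw [Q.subgoalOf_copy]
    exact congrArg some (hval i hi').symm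

theorem exists_fresh [Infinite C] (Q Q' : Query P C) :
    ∃ e : ℕ × Bool → C, e.Injective ∧ IsFresh e Q ∧ IsFresh e Q' := by
  have hfin : {c | Term.const c ∈ Q.terms ∪ Q'.terms}.Finite :=
    (Q.finite_terms.union Q'.finite_terms).preimage fun x _ y _ h => by simpa using h
  have hinf := hfin.infinite_compl.to_subtype
  obtain ⟨e⟩ : Nonempty (ℕ × Bool ↪ ↥({c | Term.const c ∈ Q.terms ∪ Q'.terms}ᶜ)) :=
    ⟨(Encodable.encode' _).trans (Infinite.natEmbedding _)⟩
  exact ⟨fun p => (e p).1, Subtype.val_injective.comp e.injective,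
    fun c hc p hp => (e p).2 (by subst hp; exact Or.inl hc),
    fun c hc p hp => (e p).2 (by subst hp; exact Or.inr hc)⟩

theorem exists_isCVM_of_equivC [Infinite C] (hQ : Q.IsCCQ arity) (hQ' : Q'.IsCCQ arity)
    (hw : Q.ExplicitWave) (h : EquivC arity Q' Q) : ∃ μ : Mapping C, μ.IsCVM Q' Q := by
  classical
  obtain ⟨e, he, hf, hf'⟩ := exists_fresh Q Q'
  obtain ⟨f, hom, hc, h1⟩ := exists_hom_weight_le hQ hQ hQ' he hf hf hf' h.symm
    (fiberCard (Q.copyImage id)) (isTemplateHom_id Q) (fun x hx => ⟨x, hx, rfl⟩)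
  obtain ⟨g, hom', hc', h2⟩ := exists_hom_weight_le hQ hQ' hQ he hf hf' hf h
    (fiberCard (Q'.copyImage f)) hom hc
  have h3 := two_mul_sum_fiberCard_le (Q.copyImage g) (Q'.copyImage f)
  -- Each sum counts pairs of copy-sensitive subgoals with equal images; the explicit-wave property
  -- says that `g` creates no new such pairs.
  have h4 : ∑ i, fiberCard (Q.copyImage g) (Q.copyImage g i) ≤
      ∑ i, fiberCard (Q.copyImage id) (Q.copyImage id i) :=
    Finset.sum_le_sum fun i _ => Finset.card_le_card fun j hj =>
      Finset.mem_filter.2 ⟨Finset.mem_univ _,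
        hw.copyImage_id_eq hQ hom' hc' (Finset.mem_filter.1 hj).2⟩
  refine exists_isCVM_of_fiberCard_eq hQ' hom hc fun τ => (fiberCard_eq_of_le _ _ ?_ ?_ τ).symm
  · exact h1.trans_eq (sum_fiberCard_comm _ _)
  · omega

theorem equivC_iff [Infinite C] (hQ : Q.IsCCQ arity) (hQ' : Q'.IsCCQ arity)
    (hw : Q.ExplicitWave) (hw' : Q'.ExplicitWave) :
    EquivC arity Q Q' ↔
      (∃ μ : Mapping C, μ.IsCVM Q Q') ∧ (∃ μ : Mapping C, μ.IsCVM Q' Q) :=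
  ⟨fun h => ⟨exists_isCVM_of_equivC hQ' hQ hw' h, exists_isCVM_of_equivC hQ hQ' hw h.symm⟩,
    fun ⟨⟨_, h⟩, ⟨_, h'⟩⟩ => ⟨containedC_of_isCVM h', containedC_of_isCVM h⟩⟩

end Query

/-! ### Decidability -/

section Primrec

variable {α β γ : Type*} [Primcodable α] [Primcodable β] [Primcodable γ]

theorem PrimrecPred.forall_mem {f : α → List β} {R : α → β → Prop} (hf : Primrec f)
    (hR : PrimrecRel R) : PrimrecPred fun a => ∀ b ∈ f a, R a b :=
  hR.swap.forall_mem_list.comp hf Primrec.id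

theorem PrimrecPred.exists_mem {f : α → List β} {R : α → β → Prop} (hf : Primrec f)
    (hR : PrimrecRel R) : PrimrecPred fun a => ∃ b ∈ f a, R a b :=
  hR.swap.exists_mem_list.comp hf Primrec.id

theorem PrimrecPred.imp {p q : α → Prop} (hp : PrimrecPred p) (hq : PrimrecPred q) :
    PrimrecPred fun a => p a → q a :=
  (hp.not.or hq).of_eq fun _ => imp_iff_not_or.symm

theorem Primrec.list_sublists : Primrec (List.sublists : List α → List (List α)) := by
  refine Primrec.of_eq (f := fun l : List α => l.foldr
    (fun a acc => acc.flatMap fun x => [x, a :: x]) [[]]) ?_ fun l => ?_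
  · refine Primrec.list_foldr (h := fun _ (p : α × List (List α)) =>
      p.2.flatMap fun x => [x, p.1 :: x])
      Primrec.id (Primrec.const _) ?_
    refine Primrec.list_flatMap (Primrec.snd.comp Primrec.snd) ?_
    refine Primrec.list_cons.comp Primrec.snd (Primrec.list_cons.comp ?_ (Primrec.const []))
    exact Primrec.list_cons.comp (Primrec.fst.comp (Primrec.snd.comp Primrec.fst)) Primrec.snd
  · rfl

theorem Primrec.list_product {f : α → List β} {g : α → List γ} (hf : Primrec f) (hg : Primrec g) :
    Primrec fun a => f a ×ˢ g a := by
  refine Primrec.list_flatMap hf ?_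
  exact Primrec.list_map (hg.comp Primrec.fst)
    (Primrec.pair (Primrec.snd.comp Primrec.fst) Primrec.snd)

variable {P C : Type*} [Primcodable P] [Primcodable C]

theorem Term.primrec_var : Primrec (Term.var : ℕ → Term C) :=
  (Primrec.of_equiv_symm (e := Term.equivSum C)).comp Primrec.sumInl

/-- Whether a term is a constant. -/
def Term.isConst (t : Term C) : Bool :=
  Sum.casesOn (Term.equivSum C t) (fun _ => false) fun _ => true

theorem Term.primrec_isConst : Primrec (Term.isConst : Term C → Bool) :=
  Primrec.sumCasesOn (Primrec.of_equiv (e := Term.equivSum C)) (Primrec.const false).to₂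
    (Primrec.const true).to₂

theorem Subgoal.primrec_pred : Primrec (Subgoal.pred : Subgoal P C → P) :=
  Primrec.fst.comp (Primrec.of_equiv (e := Subgoal.equivProd P C))

theorem Subgoal.primrec_args : Primrec (Subgoal.args : Subgoal P C → List (Term C)) :=
  Primrec.fst.comp (Primrec.snd.comp (Primrec.of_equiv (e := Subgoal.equivProd P C)))

theorem Subgoal.primrec_copy : Primrec (Subgoal.copy : Subgoal P C → Option ℕ) :=
  Primrec.snd.comp (Primrec.snd.comp (Primrec.of_equiv (e := Subgoal.equivProd P C)))

namespace Query

theorem primrec_head : Primrec (head : Query P C → List (Term C)) :=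
  Primrec.fst.comp (Primrec.of_equiv (e := equivProd P C))

theorem primrec_body : Primrec (body : Query P C → List (Subgoal P C)) :=
  Primrec.fst.comp (Primrec.snd.comp (Primrec.of_equiv (e := equivProd P C)))

theorem primrec_noncopy : Primrec (noncopy : Query P C → List ℕ) :=
  Primrec.snd.comp (Primrec.snd.comp (Primrec.of_equiv (e := equivProd P C)))

theorem primrec_copyVars : Primrec (copyVars : Query P C → List ℕ) :=
  Primrec.listFilterMap primrec_body (Subgoal.primrec_copy.comp Primrec.snd)

end Query

end Primrec

/-! ### Covering mappings as finite graphs -/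

namespace Query

variable {P C : Type*}

/-- The terms of a query, as a list. -/
def termList (Q : Query P C) : List (Term C) := Q.head ++ Q.body.flatMap Subgoal.args

theorem mem_termList {Q : Query P C} {t : Term C} : t ∈ Q.termList ↔ t ∈ Q.terms := by
  simp [termList, terms]

/-- The lists have the same length and corresponding entries are related by `R`. -/
def Related (R : List (Term C × Term C)) (l l' : List (Term C)) : Prop :=
  l.length = l'.length ∧ ∀ i ∈ List.range l.length, ∃ p ∈ R, l[i]? = some p.1 ∧ l'[i]? = some p.2

/-- Besides `l' = l.map f`, the relation records that the entries of `l` are in the domain of `R`.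
This is how a CVM graph is forced to be total, which `IsCVMGraph` does not require separately. -/
theorem related_map_iff {R : List (Term C × Term C)} {f : Term C → Term C} {l l' : List (Term C)}
    (hf : ∀ p ∈ R, f p.1 = p.2) : Related R l l' ↔ l' = l.map f ∧ ∀ t ∈ l, (t, f t) ∈ R := by
  constructor
  · rintro ⟨hlen, h⟩
    have h' : ∀ i (hi : i < l.length), (l[i], f l[i]) ∈ R ∧ l'[i]? = some (f l[i]) := by
      intro i hi
      obtain ⟨⟨a, b⟩, hp, h1, h2⟩ := h i (List.mem_range.2 hi)
      rw [List.getElem?_eq_getElem hi, Option.some.injEq] at h1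
      rw [h1, hf _ hp]
      exact ⟨hp, h2⟩
    refine ⟨List.ext_getElem? fun i => ?_, fun t ht => ?_⟩
    · rcases lt_or_ge i l.length with hi | hi
      · rw [(h' i hi).2, List.getElem?_map, List.getElem?_eq_getElem hi, Option.map_some]
      · rw [List.getElem?_eq_none (hlen ▸ hi), List.getElem?_eq_none (by simpa using hi)]
    · obtain ⟨i, hi, rfl⟩ := List.getElem_of_mem ht
      exact (h' i hi).1
  · rintro ⟨rfl, h⟩
    refine ⟨by simp, fun i hi => ?_⟩
    have hi := List.mem_range.1 hi
    exact ⟨_, h _ (List.getElem_mem hi), by simp [hi], by simp [hi]⟩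

/-- `R` and `S` are graphs of the two parts of a covering mapping. -/
def IsCVMGraph (Q' Q : Query P C) (R : List (Term C × Term C)) (S : List (ℕ × ℕ)) : Prop :=
  (∀ p ∈ R, ∀ q ∈ R, p.1 = q.1 → p.2 = q.2) ∧
  (∀ p ∈ S, ∀ q ∈ S, p.1 = q.1 → p.2 = q.2) ∧
  (∀ p ∈ R, p.1.isConst = true → p.2 = p.1) ∧
  Related R Q'.head Q.head ∧
  (∀ j ∈ Q.copyVars, ∃ p ∈ S, p.2 = j) ∧
  (∀ y ∈ Q.noncopy, ∃ p ∈ R, p.2 = .var y ∧ ∃ x ∈ Q'.noncopy, p.1 = .var x) ∧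
  (∀ g ∈ Q'.body, ∃ h ∈ Q.body, h.pred = g.pred ∧ Related R g.args h.args ∧
    (g.copy = none ∨ ∃ p ∈ S, g.copy = some p.1 ∧ h.copy = some p.2))

/-- A bounded search for a covering mapping. -/
def HasCVMGraph (Q' Q : Query P C) : Prop :=
  ∃ R ∈ (Q'.termList ×ˢ Q.termList).sublists,
    ∃ S ∈ (Q'.copyVars ×ˢ Q.copyVars).sublists, IsCVMGraph Q' Q R S

theorem HasCVMGraph.exists_isCVM {Q' Q : Query P C} (h : HasCVMGraph Q' Q) :
    ∃ μ : Mapping C, μ.IsCVM Q' Q := by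
  obtain ⟨R, hR, S, hS, h1, h2, h3, h4, h5, h6, h7⟩ := h
  have hR' : ∀ p ∈ R, p.1 ∈ Q'.terms ∧ p.2 ∈ Q.terms := fun p hp => by
    have := List.mem_product.1 ((List.mem_sublists.1 hR).subset hp)
    rwa [mem_termList, mem_termList] at this
  have hS' : ∀ p ∈ S, p.1 ∈ Q'.copyVars ∧ p.2 ∈ Q.copyVars := fun p hp =>
    List.mem_product.1 ((List.mem_sublists.1 hS).subset hp)
  -- The functional relation is extended to a function; values outside its domain are irrelevant.
  have hf : ∀ t, ∃ u, ∀ p ∈ R, p.1 = t → u = p.2 := by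
    intro t
    by_cases h : ∃ p ∈ R, p.1 = t
    · obtain ⟨p, hp, rfl⟩ := h
      exact ⟨p.2, fun q hq hqp => h1 p hp q hq hqp.symm⟩
    · exact ⟨t, fun p hp hpt => absurd ⟨p, hp, hpt⟩ h⟩
  have hc : ∀ i, ∃ j, ∀ p ∈ S, p.1 = i → j = p.2 := by
    intro i
    by_cases h : ∃ p ∈ S, p.1 = i
    · obtain ⟨p, hp, rfl⟩ := h
      exact ⟨p.2, fun q hq hqp => h2 p hp q hq hqp.symm⟩
    · exact ⟨i, fun p hp hpt => absurd ⟨p, hp, hpt⟩ h⟩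
  choose f hf using hf
  choose c hc using hc
  have hrel {l l'} := related_map_iff (R := R) (f := f) (l := l) (l' := l')
    fun p hp => hf _ p hp rfl
  have hmem : ∀ t ∈ Q'.terms, (t, f t) ∈ R := by
    rintro t (ht | ⟨g, hg, ht⟩)
    · exact (hrel.1 h4).2 t ht
    · obtain ⟨h, -, -, hr, -⟩ := h7 g hg
      exact (hrel.1 hr).2 t ht
  have hcopy : ∀ i ∈ Q'.copyVars, c i ∈ Q.copyVars := by
    intro i hi
    obtain ⟨g, hg, hgi⟩ := mem_copyVars.1 hi
    obtain ⟨h, -, -, -, hn | ⟨p, hp, hp1, -⟩⟩ := h7 g hg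
    · simp [hn] at hgi
    · rw [hc i p hp (Option.some.inj (hp1.symm.trans hgi))]
      exact (hS' p hp).2
  refine ⟨⟨f, c⟩, fun t ht => (hR' _ (hmem t ht)).2, hcopy, fun a ha => h3 _ (hmem _ ha) rfl,
    (hrel.1 h4).1.symm, ?_, ?_, ?_, ?_⟩
  · ext j
    constructor
    · rintro ⟨i, hi, rfl⟩
      exact hcopy i hi
    · intro hj
      obtain ⟨p, hp, rfl⟩ := h5 j hj
      exact ⟨p.1, (hS' p hp).1, hc _ p hp rfl⟩
  · rintro _ ⟨y, hy, rfl⟩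
    obtain ⟨p, hp, hpy, x, hx, hpx⟩ := h6 y hy
    exact ⟨_, ⟨x, hx, rfl⟩, (hf _ p hp hpx).trans hpy⟩
  · intro g hg _
    obtain ⟨h, hh, hp, hr, -⟩ := h7 g hg
    exact ⟨h, hh, hp, (hrel.1 hr).1⟩
  · intro g hg i hi
    obtain ⟨h, hh, hp, hr, hn | ⟨p, hpS, hp1, hp2⟩⟩ := h7 g hg
    · simp [hn] at hi
    · refine ⟨h, hh, hp, (hrel.1 hr).1, ?_⟩
      rw [hp2]
      exact congrArg some (hc i p hpS (Option.some.inj (hp1.symm.trans hi))).symm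

theorem hasCVMGraph_of_isCVM {arity : P → ℕ+} {Q' Q : Query P C} (hQ' : Q'.IsCCQ arity)
    {μ : Mapping C} (hμ : μ.IsCVM Q' Q) : HasCVMGraph Q' Q := by
  classical
  obtain ⟨R, hRs, hR⟩ : ∃ R ∈ (Q'.termList ×ˢ Q.termList).sublists,
      ∀ p, p ∈ R ↔ p.1 ∈ Q'.terms ∧ p.2 = μ.onTerm p.1 := by
    refine ⟨(Q'.termList ×ˢ Q.termList).filter (fun p => p.2 = μ.onTerm p.1),
      List.mem_sublists.2 List.filter_sublist, ?_⟩
    rintro ⟨a, b⟩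
    rw [List.mem_filter, decide_eq_true_eq, ← mem_termList, List.mem_product]
    refine and_congr_left fun h => and_iff_left_of_imp fun h' => ?_
    rw [show b = _ from h, mem_termList]
    exact hμ.mapsTo_terms _ (mem_termList.1 h')
  obtain ⟨S, hSs, hS⟩ : ∃ S ∈ (Q'.copyVars ×ˢ Q.copyVars).sublists,
      ∀ p, p ∈ S ↔ p.1 ∈ Q'.copyVars ∧ p.2 = μ.onCopy p.1 := by
    refine ⟨(Q'.copyVars ×ˢ Q.copyVars).filter (fun p => p.2 = μ.onCopy p.1),
      List.mem_sublists.2 List.filter_sublist, ?_⟩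
    rintro ⟨a, b⟩
    rw [List.mem_filter, decide_eq_true_eq, List.mem_product]
    refine and_congr_left fun h => and_iff_left_of_imp fun h' => ?_
    rw [show b = _ from h]
    exact hμ.mapsTo_copyVars _ h'
  have hrel {l l'} := related_map_iff (R := R) (f := μ.onTerm) (l := l) (l' := l')
    fun p hp => ((hR p).1 hp).2.symm
  refine ⟨R, hRs, S, hSs, ?_, ?_, ?_, ?_, ?_, ?_, ?_⟩
  · intro p hp q hq h
    rw [((hR p).1 hp).2, ((hR q).1 hq).2, h]
  · intro p hp q hq h
    rw [((hS p).1 hp).2, ((hS q).1 hq).2, h]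
  · rintro ⟨_ | c, u⟩ hp h
    · cases h
    · exact ((hR _).1 hp).2.trans (hμ.const c ((hR _).1 hp).1)
  · exact hrel.2 ⟨hμ.head.symm, fun t ht => (hR _).2 ⟨Or.inl ht, rfl⟩⟩
  · intro j hj
    obtain ⟨i, hi, rfl⟩ := hμ.copy_image.symm.subset hj
    exact ⟨(i, μ.onCopy i), (hS _).2 ⟨hi, rfl⟩, rfl⟩
  · intro y hy
    obtain ⟨_, ⟨x, hx, rfl⟩, h⟩ := hμ.noncopy_image ⟨y, hy, rfl⟩
    obtain ⟨g, hg, hxg⟩ := hQ'.noncopy_in_body x hx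
    exact ⟨_, (hR (.var x, μ.onTerm (.var x))).2 ⟨Or.inr ⟨g, hg, hxg⟩, rfl⟩, h, x, hx, rfl⟩
  · intro g hg
    have hargs : ∀ t ∈ g.args, (t, μ.onTerm t) ∈ R := fun t ht =>
      (hR _).2 ⟨Or.inr ⟨g, hg, ht⟩, rfl⟩
    rcases hgc : g.copy with _ | i
    · obtain ⟨h, hh, hp, ha⟩ := hμ.relational g hg hgc
      exact ⟨h, hh, hp, hrel.2 ⟨ha, hargs⟩, Or.inl rfl⟩
    · obtain ⟨h, hh, hp, ha, hc⟩ := hμ.copySensitive g hg i hgc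
      exact ⟨h, hh, hp, hrel.2 ⟨ha, hargs⟩, Or.inr ⟨(i, μ.onCopy i),
        (hS _).2 ⟨mem_copyVars.2 ⟨g, hg, hgc⟩, rfl⟩, rfl, hc⟩⟩

/-! ### Primitive recursiveness of the search -/

section Primrec

variable [Primcodable P] [Primcodable C]

theorem primrec_termList : Primrec (termList : Query P C → List (Term C)) :=
  Primrec.list_append.comp primrec_head
    (Primrec.list_flatMap primrec_body (Subgoal.primrec_args.comp Primrec.snd))

open Primrec in
theorem primrecPred_related {α : Type*} [Primcodable α] {R : α → List (Term C × Term C)}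
    {l l' : α → List (Term C)} (hR : Primrec R) (hl : Primrec l) (hl' : Primrec l') :
    PrimrecPred fun a => Related (R a) (l a) (l' a) := by
  refine (Primrec.eq.comp (list_length.comp hl) (list_length.comp hl')).and ?_
  refine PrimrecPred.forall_mem (list_range.comp (list_length.comp hl)) ?_
  refine PrimrecPred.exists_mem (hR.comp fst) ?_
  refine (Primrec.eq.comp (list_getElem?.comp (hl.comp (fst.comp fst)) (snd.comp fst))
    (option_some.comp (fst.comp snd))).and ?_
  exact Primrec.eq.comp (list_getElem?.comp (hl'.comp (fst.comp fst)) (snd.comp fst))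
    (option_some.comp (snd.comp snd))

open Primrec in
theorem primrecPred_functional {α β : Type*} [Primcodable α] [Primcodable β]
    {R : α → List (β × β)} (hR : Primrec R) :
    PrimrecPred fun a => ∀ p ∈ R a, ∀ q ∈ R a, p.1 = q.1 → p.2 = q.2 := by
  refine PrimrecPred.forall_mem hR (PrimrecPred.forall_mem (hR.comp fst) ?_)
  exact (Primrec.eq.comp (fst.comp (snd.comp fst)) (fst.comp snd)).imp
    (Primrec.eq.comp (snd.comp (snd.comp fst)) (snd.comp snd))

open Primrec in
theorem primrecPred_isCVMGraph {α : Type*} [Primcodable α] {Q' Q : α → Query P C}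
    {R : α → List (Term C × Term C)} {S : α → List (ℕ × ℕ)}
    (hQ' : Primrec Q') (hQ : Primrec Q) (hR : Primrec R) (hS : Primrec S) :
    PrimrecPred fun a => IsCVMGraph (Q' a) (Q a) (R a) (S a) := by
  refine (primrecPred_functional hR).and ((primrecPred_functional hS).and (PrimrecPred.and ?_
    ((primrecPred_related hR (primrec_head.comp hQ') (primrec_head.comp hQ)).and
      (PrimrecPred.and ?_ (PrimrecPred.and ?_ ?_)))))
  · refine PrimrecPred.forall_mem hR (PrimrecPred.imp ?_ ?_)
    · exact Primrec.eq.comp (Term.primrec_isConst.comp (fst.comp snd)) (const true)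
    · exact Primrec.eq.comp (snd.comp snd) (fst.comp snd)
  · refine PrimrecPred.forall_mem (primrec_copyVars.comp hQ)
      (PrimrecPred.exists_mem (hS.comp fst) ?_)
    exact Primrec.eq.comp (snd.comp snd) (snd.comp fst)
  · refine PrimrecPred.forall_mem (primrec_noncopy.comp hQ)
      (PrimrecPred.exists_mem (hR.comp fst) (PrimrecPred.and ?_ ?_))
    · exact Primrec.eq.comp (snd.comp snd) (Term.primrec_var.comp (snd.comp fst))
    · refine PrimrecPred.exists_mem (primrec_noncopy.comp (hQ'.comp (fst.comp fst))) ?_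
      exact Primrec.eq.comp (fst.comp (snd.comp fst)) (Term.primrec_var.comp snd)
  · refine PrimrecPred.forall_mem (primrec_body.comp hQ')
      (PrimrecPred.exists_mem (primrec_body.comp (hQ.comp fst)) (PrimrecPred.and ?_
        (PrimrecPred.and ?_ (PrimrecPred.or ?_ ?_))))
    · exact Primrec.eq.comp (Subgoal.primrec_pred.comp snd)
        (Subgoal.primrec_pred.comp (snd.comp fst))
    · exact primrecPred_related (hR.comp (fst.comp fst)) (Subgoal.primrec_args.comp (snd.comp fst))
        (Subgoal.primrec_args.comp snd)
    · exact Primrec.eq.comp (Subgoal.primrec_copy.comp (snd.comp fst)) (const none)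
    · refine PrimrecPred.exists_mem (hS.comp (fst.comp fst)) (PrimrecPred.and ?_ ?_)
      · exact Primrec.eq.comp (Subgoal.primrec_copy.comp (snd.comp (fst.comp fst)))
          (option_some.comp (fst.comp snd))
      · exact Primrec.eq.comp (Subgoal.primrec_copy.comp (snd.comp fst))
          (option_some.comp (snd.comp snd))

open Primrec in
theorem primrecPred_hasCVMGraph {α : Type*} [Primcodable α] {Q' Q : α → Query P C}
    (hQ' : Primrec Q') (hQ : Primrec Q) : PrimrecPred fun a => HasCVMGraph (Q' a) (Q a) := by
  refine PrimrecPred.exists_mem (list_sublists.comp (list_product (primrec_termList.comp hQ')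
    (primrec_termList.comp hQ))) ?_
  refine PrimrecPred.exists_mem (list_sublists.comp (list_product
    (primrec_copyVars.comp (hQ'.comp fst)) (primrec_copyVars.comp (hQ.comp fst)))) ?_
  exact primrecPred_isCVMGraph (hQ'.comp (fst.comp fst)) (hQ.comp (fst.comp fst))
    (snd.comp fst) snd

end Primrec

theorem hasCVMGraph_iff {arity : P → ℕ+} {Q' Q : Query P C} (hQ : Q'.IsCCQ arity) :
    HasCVMGraph Q' Q ↔ ∃ μ : Mapping C, μ.IsCVM Q' Q :=
  ⟨HasCVMGraph.exists_isCVM, fun ⟨_, h⟩ => hasCVMGraph_of_isCVM hQ h⟩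

end Query

theorem mainTheorem1 {P C : Type*} [Infinite C] :
    (∀ (arity : P → ℕ+) (Q₁ Q₂ : Query P C),
      Q₁.IsCCQ arity → Q₂.IsCCQ arity → Q₁.ExplicitWave → Q₂.ExplicitWave →
      (Query.EquivC arity Q₁ Q₂ ↔
        (∃ μ : Mapping C, μ.IsCVM Q₁ Q₂) ∧ (∃ μ : Mapping C, μ.IsCVM Q₂ Q₁))) ∧
    (∀ [Primcodable P] [Primcodable C],
      ∃ f : Query P C × Query P C → Bool, Computable f ∧
        ∀ (arity : P → ℕ+) (Q₁ Q₂ : Query P C),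
          Q₁.IsCCQ arity → Q₂.IsCCQ arity → Q₁.ExplicitWave → Q₂.ExplicitWave →
          (f (Q₁, Q₂) = true ↔ Query.EquivC arity Q₁ Q₂)) := by
  refine ⟨fun arity Q₁ Q₂ h₁ h₂ w₁ w₂ => Query.equivC_iff h₁ h₂ w₁ w₂, ?_⟩
  intro _ _
  classical
  -- The search does not involve the arities, so one function serves all of them.
  refine ⟨fun p => decide (Query.HasCVMGraph p.1 p.2 ∧ Query.HasCVMGraph p.2 p.1),
    ((Query.primrecPred_hasCVMGraph Primrec.fst Primrec.snd).and
      (Query.primrecPred_hasCVMGraph Primrec.snd Primrec.fst)).decide.to_comp, ?_⟩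
  intro arity Q₁ Q₂ h₁ h₂ w₁ w₂
  rw [decide_eq_true_iff, Query.equivC_iff h₁ h₂ w₁ w₂, Query.hasCVMGraph_iff h₁,
    Query.hasCVMGraph_iff h₂]
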